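/- **Conventions.** Operator spaces are complex: an operator space $X$ is a Banach space realised (linearly, isometrically) as a closed subspace of some $\mathcal B(K)$, $K$ a Hilbert space, and $\mathrm M_n(X)$ is normed as a subspace of $\mathcal B(K^{\oplus n})$. For $f:X\to Y$ the $n$-th amplification is $f_n([x_{ij}])=[f(x_{ij})]$, and $\mathrm{Dist}_n(f)$ is the infimum of all $D>0$ for which there is $r>0$ with $r\|A-B\|\le\|f_n(A)-f_n(B)\|\le Dr\|A-B\|$ for all $A,B\in \mathrm M_n(X)$ (and $\infty$ if there is no such $D$). A sequence of maps $(f^n:X\to Y)_{n\ge 1}$ is an *almost complete isometric embedding* if, for each $n$, the $n$-th amplification of $f^n$ is an isometry, and an *almost complete Lipschitz embedding* if there is $D>0$ with $\mathrm{Dist}_n(f^n)\le D$ for all $n$. If all $f^n$ are moreover $\mathbb R$-linear, it is called an *almost complete $\mathbb R$-linearly isometric embedding*, respectively an *almost complete $\mathbb R$-isomorphic embedding*. $X$ *$\mathbb R$-isomorphically embeds* into $Y$ if there are an $\mathbb R$-linear bounded map $T:X\to Y$ and $c>0$ with $\|Tx\|\ge c\|x\|$ for all $x$. $X$ is *Hilbertian*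 if it is linearly isomorphic, as a Banach space, to a Hilbert space (e.g. if its norm is a Hilbert space norm). For $n\ge1$, $\mathrm{Lip}_0^n(X,\mathbb C)$ is the space of all Lipschitz $f:X\to\mathbb C$ with $f(0)=0$, where the norm of $[f_{ml}]\in \mathrm M_k(\mathrm{Lip}_0^n(X,\mathbb C))$ is the Lipschitz constant of the $n$-th amplification $\mathrm M_n(X)\to \mathrm M_n(\mathrm M_k)$ of $[f_{ml}]:X\to \mathrm M_k$. Its dual is an operator space via $\mathrm M_m(E^*)=\mathrm{CB}(E,\mathrm M_m)$, and $\mathcal F^n(X)$ is the closed linear span of the evaluations $\delta_x$, $x\in X$, in $\mathrm{Lip}_0^n(X,\mathbb C)^*$, with the inherited operator space structure. $c_0$-sums carry the supremum matrix norms. **Theorem.** Let $H$ be any nonseparable Hilbertian operator space and $Y=\big(\bigoplus_{n\ge1}\mathcal F^n(H)\big)_{c_0}$. Then $H$ almost completely isometrically embeds into $Y$, but $H$ does not $\mathbb R$-isomorphically embed into $Y$. In particular, there are operator spaces $X$ and $Y$, with $X$ Hilbertian and nonseparable, such that $X$ almost completely isometrically embeds into $Y$ but does not $\mathbb R$-isomorphically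 embed into $Y$. Consequently: 1. Almost complete isometric embeddability is strictly weaker than almost complete $\mathbb R$-linearly isometric embeddability: the latter always implies the former, and there are operator spaces $X,Y$ for which the former holds and the latter fails. 2. Almost complete Lipschitz embeddability is strictly weaker than almost complete $\mathbb R$-isomorphic embeddability: the latter always implies the former, and there are operator spaces $X,Y$ for which the former holds and the latter fails. -/

import Mathlib

open scoped ENNReal NNReal Topology

universe u v w

noncomputable section

namespace OperatorSpaces

/-! ### Block operators on `K^{⊕n}` -/

/-- The operator on the Hilbert space `K^{⊕n}` (the `ℓ²`-sum of `n` copies of `K`) given by a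
matrix `A ∈ M_n(B(K))`:  `(A x)_i = ∑_j A_{ij} x_j`. -/
def blockOp {K : Type*} [NormedAddCommGroup K] [NormedSpace ℂ K] {n : ℕ}
    (A : Matrix (Fin n) (Fin n) (K →L[ℂ] K)) :
    PiLp 2 (fun _ : Fin n => K) →L[ℂ] PiLp 2 (fun _ : Fin n => K) :=
  ((PiLp.continuousLinearEquiv 2 ℂ (fun _ : Fin n => K)).symm :
      (Fin n → K) →L[ℂ] PiLp 2 (fun _ : Fin n => K)) ∘L
    (ContinuousLinearMap.pi fun i => ∑ j, (A i j) ∘L (ContinuousLinearMap.proj j)) ∘L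
    ((PiLp.continuousLinearEquiv 2 ℂ (fun _ : Fin n => K)) :
      PiLp 2 (fun _ : Fin n => K) →L[ℂ] (Fin n → K))

section blockOp

variable {K : Type*} [NormedAddCommGroup K] [NormedSpace ℂ K] {n : ℕ}

theorem blockOp_apply (A : Matrix (Fin n) (Fin n) (K →L[ℂ] K)) (x : PiLp 2 (fun _ : Fin n => K))
    (i : Fin n) : blockOp A x i = ∑ j, A i j (x j) := by
  simp [blockOp]

theorem blockOp_zero : blockOp (0 : Matrix (Fin n) (Fin n) (K →L[ℂ] K)) = 0 := by
  ext x i; simp [blockOp_apply]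

theorem blockOp_smul (c : ℂ) (A : Matrix (Fin n) (Fin n) (K →L[ℂ] K)) :
    blockOp (c • A) = c • blockOp A := by
  ext x i; simp [blockOp_apply, Finset.smul_sum]

theorem norm_entry_le (A : Matrix (Fin n) (Fin n) (K →L[ℂ] K)) (i j : Fin n) :
    ‖A i j‖ ≤ ‖blockOp A‖ := by
  refine ContinuousLinearMap.opNorm_le_bound _ (norm_nonneg _) fun v => ?_
  have h1 : blockOp A (PiLp.single 2 j v) i = A i j v := by
    rw [blockOp_apply, Finset.sum_eq_single j]
    · rw [PiLp.single_eq_same]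
    · intro b _ hb
      rw [PiLp.single_eq_of_ne _ hb, map_zero]
    · simp
  rw [← h1]
  refine (PiLp.norm_apply_le _ i).trans ((ContinuousLinearMap.le_opNorm _ _).trans_eq ?_)
  rw [PiLp.norm_single]

theorem norm_blockOp_le (A : Matrix (Fin n) (Fin n) (K →L[ℂ] K)) :
    ‖blockOp A‖ ≤ ∑ i, ∑ j, ‖A i j‖ := by
  refine ContinuousLinearMap.opNorm_le_bound _ (by positivity) fun x => ?_
  have h : blockOp A x = ∑ i, PiLp.single 2 i (∑ j, A i j (x j)) := by
    ext k
    rw [blockOp_apply, WithLp.ofLp_sum, Finset.sum_apply]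
    refine ((Finset.sum_eq_single k (fun b _ hb => PiLp.single_eq_of_ne _ hb.symm _)
      (by simp)).trans ?_).symm
    exact PiLp.single_eq_same 2 k _
  rw [h, Finset.sum_mul]
  refine (norm_sum_le _ _).trans (Finset.sum_le_sum fun i _ => ?_)
  rw [PiLp.norm_single, Finset.sum_mul]
  refine (norm_sum_le _ _).trans (Finset.sum_le_sum fun j _ => ?_)
  exact ((A i j).le_opNorm _).trans
    (mul_le_mul_of_nonneg_left (PiLp.norm_apply_le _ j) (norm_nonneg _))

theorem norm_blockOp_one (A : Matrix (Fin 1) (Fin 1) (K →L[ℂ] K)) : ‖blockOp A‖ = ‖A 0 0‖ := by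
  refine le_antisymm ?_ (norm_entry_le A 0 0)
  simpa using norm_blockOp_le A

end blockOp

/-! ### Least constants -/

/-- The least constant `C ≥ 0` with `a i ≤ C * w i` for all `i`. -/
def leastConst {ι : Type*} (a w : ι → ℝ) : ℝ := sInf {C | 0 ≤ C ∧ ∀ i, a i ≤ C * w i}

section leastConst

variable {ι : Type*} {a w : ι → ℝ}

theorem leastConst_nonneg : 0 ≤ leastConst a w := Real.sInf_nonneg fun _ h => h.1

theorem leastConst_le {C : ℝ} (hC : 0 ≤ C) (h : ∀ i, a i ≤ C * w i) : leastConst a w ≤ C :=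
  csInf_le ⟨0, fun _ h => h.1⟩ ⟨hC, h⟩

theorem le_leastConst_mul (hw : ∀ i, 0 ≤ w i) (h : ∃ C, ∀ i, a i ≤ C * w i) (i : ι) :
    a i ≤ leastConst a w * w i := by
  obtain ⟨C, hC⟩ := h
  have hC' : ∀ j, a j ≤ max C 0 * w j := fun j =>
    (hC j).trans (mul_le_mul_of_nonneg_right (le_max_left _ _) (hw j))
  rcases (hw i).eq_or_lt with h0 | h0
  · have := hC i
    rw [← h0] at this ⊢
    simpa using this
  · rw [← div_le_iff₀ h0]
    refine le_csInf ⟨_, le_max_right C 0, hC'⟩ fun D hD => ?_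
    rw [div_le_iff₀ h0]
    exact hD.2 i

end leastConst

/-! ### Operator spaces -/

/-- An operator space structure on a complex normed space `V`: norms on all matrix spaces
`M_n(V)` which come from a linear isometric embedding of `V` into some `B(K)`, `K` a Hilbert
space, with `M_n(V)` normed as a subspace of `B(K^{⊕n})`.  An *operator space* is a complex Banach
space with such a structure, i.e. (up to the identification by the embedding) a closed linear
subspace of some `B(K)`. -/
class OperatorStructure (V : Type u) [NormedAddCommGroup V] [NormedSpace ℂ V] where
  /-- the norm of `M_n(V)` -/
  mnorm : ∀ n : ℕ, Matrix (Fin n) (Fin n) V → ℝ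
  exists_rep : ∃ (K : Type u) (_ : NormedAddCommGroup K) (_ : InnerProductSpace ℂ K)
    (_ : CompleteSpace K) (ρ : V →ₗᵢ[ℂ] (K →L[ℂ] K)),
    ∀ (n : ℕ) (A : Matrix (Fin n) (Fin n) V), mnorm n A = ‖blockOp (A.map ρ)‖


/-! ### Representations from families of matricial maps -/

theorem norm_sq_lp {ι : Type*} {K : ι → Type*} [∀ i, NormedAddCommGroup (K i)] (f : lp K 2) :
    HasSum (fun i => ‖f i‖ ^ 2) (‖f‖ ^ 2) := by
  have h := lp.hasSum_norm (p := 2) (by norm_num) f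
  simpa using h

section family

variable {V : Type u} [NormedAddCommGroup V] [NormedSpace ℂ V] {ι : Type v} {K : ι → Type w}
  [∀ i, NormedAddCommGroup (K i)] [∀ i, InnerProductSpace ℂ (K i)]

/-- Block diagonal operators on a Hilbert sum act blockwise. -/
theorem norm_blockOp_diag_le {n : ℕ} {D : Matrix (Fin n) (Fin n) (lp K 2 →L[ℂ] lp K 2)}
    {T : ∀ i, Matrix (Fin n) (Fin n) (K i →L[ℂ] K i)}
    (hD : ∀ a b x i, D a b x i = T i a b (x i)) {C : ℝ} (hC : 0 ≤ C) :
    ‖blockOp D‖ ≤ C ↔ ∀ i, ‖blockOp (T i)‖ ≤ C := by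
  classical
  constructor
  · intro h i
    refine ContinuousLinearMap.opNorm_le_bound _ hC fun y => ?_
    have h1 := (blockOp D).le_of_opNorm_le h
      (WithLp.toLp 2 fun b => lp.single 2 i (y b))
    have h2 : blockOp D (WithLp.toLp 2 fun b => lp.single 2 i (y b)) =
        WithLp.toLp 2 fun a => lp.single 2 i (blockOp (T i) y a) := by
      ext a j
      rw [blockOp_apply]
      simp only [lp.coeFn_sum, Finset.sum_apply, hD]
      by_cases hj : j = i
      · subst hj
        simp [blockOp_apply]
      · simp [Pi.single_eq_of_ne hj]
    have h3 : ∀ z : PiLp 2 (fun _ : Fin n => K i),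
        ‖(WithLp.toLp 2 fun b => lp.single 2 i (z b) : PiLp 2 (fun _ : Fin n => lp K 2))‖
          = ‖z‖ := by
      intro z
      rw [PiLp.norm_eq_of_L2, PiLp.norm_eq_of_L2]
      simp [lp.norm_single]
    rwa [h2, h3, h3] at h1
  · intro h
    refine ContinuousLinearMap.opNorm_le_bound _ hC fun x => ?_
    have key : ∀ z : PiLp 2 (fun _ : Fin n => lp K 2),
        HasSum (fun i => ‖(WithLp.toLp 2 fun b => z b i : PiLp 2 (fun _ : Fin n => K i))‖ ^ 2)
          (‖z‖ ^ 2) := by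
      intro z
      simp only [PiLp.norm_sq_eq_of_L2]
      exact hasSum_sum fun b _ => norm_sq_lp (z b)
    have hle := hasSum_le (fun i => ?_) (key (blockOp D x)) ((key x).mul_left (C ^ 2))
    · rw [← mul_pow] at hle
      exact le_of_sq_le_sq hle (by positivity)
    · have h4 : (WithLp.toLp 2 fun b => blockOp D x b i : PiLp 2 (fun _ : Fin n => K i)) =
          blockOp (T i) (WithLp.toLp 2 fun b => x b i) := by
        ext a
        rw [blockOp_apply]
        simp only [blockOp_apply, lp.coeFn_sum, Finset.sum_apply, hD]
      rw [h4, ← mul_pow]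
      exact pow_le_pow_left₀ (norm_nonneg _) ((blockOp (T i)).le_of_opNorm_le (h i) _) 2

variable [∀ i, CompleteSpace (K i)]

theorem exists_rep_of_family (wt : ι → ℝ) (hwt : ∀ i, 0 ≤ wt i)
    (L : ∀ i, V →ₗ[ℂ] (K i →L[ℂ] K i)) (hL : ∀ i v, ‖L i v‖ ≤ ‖v‖ * wt i)
    (hV : ∀ v C, 0 ≤ C → (∀ i, ‖L i v‖ ≤ C * wt i) → ‖v‖ ≤ C) :
    ∃ (H : Type (max v w)) (_ : NormedAddCommGroup H) (_ : InnerProductSpace ℂ H)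
      (_ : CompleteSpace H) (ρ : V →ₗᵢ[ℂ] (H →L[ℂ] H)),
      ∀ (n : ℕ) (A : Matrix (Fin n) (Fin n) V),
        leastConst (fun i => ‖blockOp (A.map (L i))‖) wt = ‖blockOp (A.map ρ)‖ := by
  have hw0 : ∀ i, wt i = 0 → ∀ v, L i v = 0 := fun i h v => by
    have := hL i v
    rw [h, mul_zero] at this
    exact norm_le_zero_iff.1 this
  have hT : ∀ v i, ‖((wt i)⁻¹ : ℂ) • L i v‖ ≤ ‖v‖ := by
    intro v i
    rw [norm_smul, norm_inv, Complex.norm_real, Real.norm_of_nonneg (hwt i)]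
    rcases (hwt i).eq_or_lt with h | h
    · rw [← h]; simp
    · rw [inv_mul_le_iff₀ h, mul_comm]; exact hL i v
  have hscale : ∀ (i : ι) (n : ℕ) (A : Matrix (Fin n) (Fin n) V) (C : ℝ), 0 ≤ C →
      (‖blockOp (((wt i)⁻¹ : ℂ) • A.map (L i))‖ ≤ C ↔ ‖blockOp (A.map (L i))‖ ≤ C * wt i) := by
    intro i n A C hC
    rw [blockOp_smul, norm_smul, norm_inv, Complex.norm_real, Real.norm_of_nonneg (hwt i)]
    rcases (hwt i).eq_or_lt with h | h
    · have : A.map (L i) = 0 := by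
        ext1 a b; exact hw0 i h.symm _
      rw [this, blockOp_zero, ← h]
      simp [hC]
    · rw [inv_mul_le_iff₀ h, mul_comm]
  let ρ₀ : V →ₗ[ℂ] (lp K 2 →L[ℂ] lp K 2) :=
    { toFun := fun v => lp.mapCLM 2 (fun i => ((wt i)⁻¹ : ℂ) • L i v) (norm_nonneg v) (hT v)
      map_add' := fun x y => by
        ext f i
        simp [smul_add]
      map_smul' := fun c x => by
        ext f i
        simp [smul_comm c] }
  have hρ : ∀ v f i, ρ₀ v f i = (((wt i)⁻¹ : ℂ) • L i v) (f i) := fun v f i => rfl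
  have hnorm : ∀ (n : ℕ) (A : Matrix (Fin n) (Fin n) V) (C : ℝ), 0 ≤ C →
      (‖blockOp (A.map ρ₀)‖ ≤ C ↔ ∀ i, ‖blockOp (A.map (L i))‖ ≤ C * wt i) := by
    intro n A C hC
    rw [norm_blockOp_diag_le (T := fun i => ((wt i)⁻¹ : ℂ) • A.map (L i)) ?_ hC]
    · exact forall_congr' fun i => hscale i n A C hC
    · intro a b x i
      exact hρ _ _ _
  have hiso : ∀ v, ‖ρ₀ v‖ = ‖v‖ := by
    intro v
    refine le_antisymm ?_ ?_
    · exact lp.norm_mapCLM_le 2 _ (norm_nonneg v) (hT v)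
    · refine hV v _ (norm_nonneg _) fun i => ?_
      have h1 := (hnorm 1 (fun _ _ => v) ‖ρ₀ v‖ (norm_nonneg _)).1
        (by rw [norm_blockOp_one]; exact le_rfl) i
      rw [norm_blockOp_one] at h1
      exact h1
  refine ⟨lp K 2, inferInstance, inferInstance, inferInstance, ⟨ρ₀, hiso⟩, fun n A => ?_⟩
  refine le_antisymm (leastConst_le (norm_nonneg _) ?_) (le_csInf ?_ fun C hC => ?_)
  · exact (hnorm n A _ (norm_nonneg _)).1 le_rfl
  · exact ⟨_, norm_nonneg _, (hnorm n A _ (norm_nonneg _)).1 le_rfl⟩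
  · exact (hnorm n A C hC.1).2 hC.2

end family

namespace OperatorStructure

section basic

variable {V : Type u} [NormedAddCommGroup V] [NormedSpace ℂ V] [OperatorStructure V] {n : ℕ}

theorem norm_entry_le_mnorm (A : Matrix (Fin n) (Fin n) V) (i j : Fin n) :
    ‖A i j‖ ≤ mnorm n A := by
  obtain ⟨K, _, _, _, ρ, hρ⟩ := exists_rep (V := V)
  rw [hρ, ← ρ.norm_map]
  exact norm_entry_le (A.map ρ) i j

theorem mnorm_nonneg (A : Matrix (Fin n) (Fin n) V) : 0 ≤ mnorm n A := by
  obtain ⟨K, _, _, _, ρ, hρ⟩ := exists_rep (V := V)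
  rw [hρ]
  exact norm_nonneg _

theorem mnorm_le_sum (A : Matrix (Fin n) (Fin n) V) : mnorm n A ≤ ∑ i, ∑ j, ‖A i j‖ := by
  obtain ⟨K, _, _, _, ρ, hρ⟩ := exists_rep (V := V)
  rw [hρ]
  simpa using norm_blockOp_le (A.map ρ)

theorem mnorm_one (A : Matrix (Fin 1) (Fin 1) V) : mnorm 1 A = ‖A 0 0‖ := by
  refine le_antisymm ?_ (norm_entry_le_mnorm A 0 0)
  simpa using mnorm_le_sum A

/-- `‖∑ conj(η_s) ξ_t A_{st}‖ ≤ ‖A‖ ‖η‖ ‖ξ‖`. -/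
theorem norm_compress_le (A : Matrix (Fin n) (Fin n) V) (η ξ : EuclideanSpace ℂ (Fin n)) :
    ‖∑ s, ∑ t, (star (η s) * ξ t) • A s t‖ ≤ mnorm n A * ‖ξ‖ * ‖η‖ := by
  obtain ⟨K, _, _, _, ρ, hρ⟩ := exists_rep (V := V)
  rw [hρ, ← ρ.norm_map]
  refine ContinuousLinearMap.opNorm_le_bound _ (by positivity) fun v => ?_
  have hn : ∀ (ζ : EuclideanSpace ℂ (Fin n)) (u : K),
      ‖(WithLp.toLp 2 fun t => ζ t • u : PiLp 2 (fun _ : Fin n => K))‖ = ‖ζ‖ * ‖u‖ := by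
    intro ζ u
    rw [PiLp.norm_eq_of_L2, EuclideanSpace.norm_eq]
    simp only [norm_smul, mul_pow, ← Finset.sum_mul]
    rw [Real.sqrt_mul (by positivity), Real.sqrt_sq (norm_nonneg _)]
  set z := ρ (∑ s, ∑ t, (star (η s) * ξ t) • A s t) v with hz
  have hin : inner ℂ z z = inner ℂ (WithLp.toLp 2 fun s => η s • z : PiLp 2 (fun _ : Fin n => K))
      (blockOp (A.map ρ) (WithLp.toLp 2 fun t => ξ t • v)) := by
    nth_rewrite 2 [hz]
    rw [PiLp.inner_apply]
    simp only [blockOp_apply, map_sum, map_smul, sum_apply, inner_sum,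
      smul_apply, inner_smul_right, inner_smul_left, Matrix.map_apply, mul_assoc]
    exact Finset.sum_congr rfl fun s _ => Finset.sum_congr rfl fun t _ => mul_left_comm _ _ _
  have h1 : ‖z‖ * ‖z‖ ≤ (‖η‖ * ‖z‖) * (‖blockOp (A.map ρ)‖ * (‖ξ‖ * ‖v‖)) := by
    have h2 : ‖z‖ * ‖z‖ = ‖(inner ℂ z z : ℂ)‖ := by
      rw [inner_self_eq_norm_sq_to_K]; simp [sq]
    rw [h2, hin, ← hn, ← hn]
    exact (norm_inner_le_norm _ _).trans (mul_le_mul_of_nonneg_left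
      (ContinuousLinearMap.le_opNorm _ _) (norm_nonneg _))
  rcases (norm_nonneg z).eq_or_lt with h0 | h0
  · rw [← h0]; positivity
  · refine le_of_mul_le_mul_right ?_ h0
    linarith

end basic

end OperatorStructure

open OperatorStructure

/-- The operator on the Hilbert space `ℂ^n` with matrix `M`; its norm is the norm of `M` in
`M_n = M_n(ℂ)`. -/
def scalarOp {n : ℕ} (M : Matrix (Fin n) (Fin n) ℂ) :
    EuclideanSpace ℂ (Fin n) →L[ℂ] EuclideanSpace ℂ (Fin n) :=
  Matrix.toEuclideanCLM (n := Fin n) (𝕜 := ℂ) M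

section scalarOp

variable {n : ℕ}

theorem scalarOp_apply (M : Matrix (Fin n) (Fin n) ℂ) (x : EuclideanSpace ℂ (Fin n)) (i : Fin n) :
    scalarOp M x i = ∑ j, M i j * x j := by
  simp [scalarOp, Matrix.mulVec, dotProduct]

theorem norm_entry_le_scalarOp (M : Matrix (Fin n) (Fin n) ℂ) (i j : Fin n) :
    ‖M i j‖ ≤ ‖scalarOp M‖ := by
  have h1 : scalarOp M (EuclideanSpace.single j 1) i = M i j := by
    rw [scalarOp_apply]; simp
  rw [← h1]
  refine (PiLp.norm_apply_le _ i).trans ((ContinuousLinearMap.le_opNorm _ _).trans_eq ?_)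
  simp

theorem norm_scalarOp_le (M : Matrix (Fin n) (Fin n) ℂ) : ‖scalarOp M‖ ≤ ∑ i, ∑ j, ‖M i j‖ := by
  refine ContinuousLinearMap.opNorm_le_bound _ (by positivity) fun x => ?_
  have h : scalarOp M x = ∑ i, EuclideanSpace.single i (∑ j, M i j * x j) := by
    ext k
    rw [scalarOp_apply, WithLp.ofLp_sum, Finset.sum_apply]
    simp
  rw [h, Finset.sum_mul]
  refine (norm_sum_le _ _).trans (Finset.sum_le_sum fun i _ => ?_)
  rw [PiLp.norm_single, Finset.sum_mul]
  refine (norm_sum_le _ _).trans (Finset.sum_le_sum fun j _ => ?_)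
  rw [norm_mul]
  exact mul_le_mul_of_nonneg_left (PiLp.norm_apply_le _ j) (norm_nonneg _)

end scalarOp

/-! ### Duals, subspaces and direct sums -/

/-- For `e ∈ M_k(E)`, the map `E^* → M_k = B(ℂ^k)`, `φ ↦ [φ(e_{st})]`. -/
def dualEval {E : Type u} [NormedAddCommGroup E] [NormedSpace ℂ E]
    (e : Σ k : ℕ, Matrix (Fin k) (Fin k) E) :
    StrongDual ℂ E →ₗ[ℂ] (EuclideanSpace ℂ (Fin e.1) →L[ℂ] EuclideanSpace ℂ (Fin e.1)) where
  toFun φ := scalarOp (e.2.map φ)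
  map_add' φ ψ := by
    ext x i; simp [scalarOp_apply, add_mul, Finset.sum_add_distrib]
  map_smul' c φ := by
    ext x i; simp [scalarOp_apply, Finset.mul_sum, mul_assoc]

theorem norm_dualEval_le {E : Type u} [NormedAddCommGroup E] [NormedSpace ℂ E]
    [OperatorStructure E] (e : Σ k : ℕ, Matrix (Fin k) (Fin k) E) (φ : StrongDual ℂ E) :
    ‖dualEval e φ‖ ≤ ‖φ‖ * mnorm e.1 e.2 := by
  have hm := mnorm_nonneg e.2
  refine ContinuousLinearMap.opNorm_le_bound _ (by positivity) fun ξ => ?_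
  set y := dualEval e φ ξ with hy
  have hin : inner ℂ y y = φ (∑ s, ∑ t, (star (y s) * ξ t) • e.2 s t) := by
    nth_rewrite 2 [hy]
    rw [PiLp.inner_apply]
    simp only [map_sum, map_smul, smul_eq_mul]
    refine Finset.sum_congr rfl fun s _ => ?_
    have : (dualEval e φ ξ) s = ∑ t, φ (e.2 s t) * ξ t := scalarOp_apply _ _ _
    rw [this, inner_sum]
    refine Finset.sum_congr rfl fun t _ => ?_
    simp only [RCLike.inner_apply, starRingEnd_apply]
    ring
  have h1 : ‖y‖ * ‖y‖ ≤ ‖φ‖ * (mnorm e.1 e.2 * ‖ξ‖ * ‖y‖) := by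
    have h2 : ‖y‖ * ‖y‖ = ‖(inner ℂ y y : ℂ)‖ := by
      rw [inner_self_eq_norm_sq_to_K]; simp [sq]
    rw [h2, hin]
    exact (φ.le_opNorm _).trans
      (mul_le_mul_of_nonneg_left (norm_compress_le _ _ _) (norm_nonneg _))
  rcases (norm_nonneg y).eq_or_lt with h0 | h0
  · rw [← h0]; positivity
  · refine le_of_mul_le_mul_right ?_ h0
    linarith

/-- The dual operator space `E^*`: the norm of `[φ_{ij}] ∈ M_m(E^*)` is the cb-norm of the map
`E → M_m`, `e ↦ [φ_{ij}(e)]`, i.e. the least `C ≥ 0` such that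
`‖[φ_{ij}(e_{st})]‖ ≤ C ‖[e_{st}]‖` for all `k` and all `[e_{st}] ∈ M_k(E)`. The norm on the left is
that of `M_m(M_k) = M_{mk} = M_k(M_m)`. -/
instance dualOperatorStructure (E : Type u) [NormedAddCommGroup E] [NormedSpace ℂ E]
    [OperatorStructure E] : OperatorStructure (StrongDual ℂ E) where
  mnorm _ Φ := leastConst
    (fun e : Σ k : ℕ, Matrix (Fin k) (Fin k) E => ‖blockOp (Φ.map (dualEval e))‖)
    (fun e => mnorm e.1 e.2)
  exists_rep := by
    refine exists_rep_of_family (fun e : Σ k : ℕ, Matrix (Fin k) (Fin k) E => mnorm e.1 e.2)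
      (fun e => mnorm_nonneg _) dualEval (fun e φ => norm_dualEval_le e φ) fun φ C hC h => ?_
    refine ContinuousLinearMap.opNorm_le_bound _ hC fun x => ?_
    have h1 := h ⟨1, fun _ _ => x⟩
    rw [mnorm_one] at h1
    exact (norm_entry_le_scalarOp (Matrix.map (fun _ _ => x : Matrix (Fin 1) (Fin 1) E) φ) 0 0).trans
      h1

/-- A subspace of an operator space inherits its matrix norms. -/
instance submoduleOperatorStructure {E : Type u} [NormedAddCommGroup E] [NormedSpace ℂ E]
    [OperatorStructure E] (W : Submodule ℂ E) : OperatorStructure W where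
  mnorm n A := mnorm n (A.map (W.subtype : W → E))
  exists_rep := by
    obtain ⟨K, i1, i2, i3, ρ, hρ⟩ := exists_rep (V := E)
    exact ⟨K, i1, i2, i3, ρ.comp W.subtypeₗᵢ, fun n A => hρ n _⟩

section sums

variable {ι : Type v} (E : ι → Type u) [∀ i, NormedAddCommGroup (E i)] [∀ i, NormedSpace ℂ (E i)]

/-- The `ℓ^∞`-sum of operator spaces: `‖[y_{ab}]‖ = sup_i ‖[y_{ab}(i)]‖`. -/
instance lpOperatorStructure [∀ i, OperatorStructure (E i)] : OperatorStructure (lp E ∞) where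
  mnorm n A := leastConst (fun i => mnorm n (A.map fun y => y i)) (fun _ => 1)
  exists_rep := by
    choose K i1 i2 i3 ρ hρ using fun i => exists_rep (V := E i)
    let L : ∀ i, lp E ∞ →ₗ[ℂ] (K i →L[ℂ] K i) := fun i =>
      { toFun := fun y => ρ i (y i)
        map_add' := fun x y => by simp
        map_smul' := fun c x => by simp }
    have hL : ∀ i y, ‖L i y‖ = ‖y i‖ := fun i y => (ρ i).norm_map _
    obtain ⟨H, j1, j2, j3, σ, hσ⟩ := exists_rep_of_family (fun _ => 1) (fun _ => zero_le_one) L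
      (fun i y => by
        rw [hL, mul_one]
        exact lp.norm_apply_le_norm (by simp) y i)
      (fun y C hC h => lp.norm_le_of_forall_le hC fun i => by
        rw [← hL, ← mul_one C]
        exact h i)
    refine ⟨H, j1, j2, j3, σ, fun n A => ?_⟩
    rw [← hσ]
    congr 1
    ext i
    exact hρ i n _

/-- The `c₀`-sum `(⊕_i E_i)_{c₀}`: the families `y` with `‖y i‖ → 0`, with the supremum norm, as a
subspace of the `ℓ^∞`-sum. -/
def c0Sum : Submodule ℂ (lp E ∞) where
  carrier := {y | Filter.Tendsto (fun i => ‖y i‖) Filter.cofinite (𝓝 0)}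
  zero_mem' := by simpa using tendsto_const_nhds
  add_mem' := by
    intro x y hx hy
    refine squeeze_zero (fun i => norm_nonneg _) (fun i => norm_add_le (x i) (y i)) ?_
    simpa using Filter.Tendsto.add hx hy
  smul_mem' := by
    intro c x hx
    have : Filter.Tendsto (fun i => ‖c‖ * ‖x i‖) Filter.cofinite (𝓝 (‖c‖ * 0)) :=
      Filter.Tendsto.const_mul _ hx
    simpa [norm_smul] using this

theorem isClosed_c0Sum : IsClosed (c0Sum E : Set (lp E ∞)) := by
  rw [← isSeqClosed_iff_isClosed]
  intro x y hx hxy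
  refine Metric.tendsto_nhds.2 fun ε hε => ?_
  obtain ⟨N, hN⟩ := ((Metric.tendsto_nhds.1 hxy) (ε / 2) (by positivity)).exists
  filter_upwards [(Metric.tendsto_nhds.1 (hx N)) (ε / 2) (by positivity)] with i hi
  rw [dist_zero_right, norm_norm] at hi ⊢
  rw [dist_eq_norm] at hN
  have h1 := lp.norm_apply_le_norm (p := ∞) (by simp) (x N - y) i
  have h2 : ‖y i‖ ≤ ‖x N i‖ + ‖(x N - y) i‖ := by
    have : y i = x N i - (x N - y) i := by simp
    nth_rewrite 1 [this]
    exact norm_sub_le _ _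
  linarith

instance c0SumOperatorStructure [∀ i, OperatorStructure (E i)] : OperatorStructure (c0Sum E) :=
  submoduleOperatorStructure (E := lp E ∞) (c0Sum E)

instance completeSpace_c0Sum [∀ i, CompleteSpace (E i)] : CompleteSpace (c0Sum E) :=
  (isClosed_c0Sum E).completeSpace_coe

end sums

/-! ### Lipschitz spaces and Lipschitz-free operator spaces -/

/-- `Lip₀(X, ℂ)`: the Lipschitz functions `f : X → ℂ` with `f(0) = 0`. -/
def lipZero (X : Type u) [NormedAddCommGroup X] : Submodule ℂ (X → ℂ) where
  carrier := {f | (∃ C : ℝ≥0, LipschitzWith C f) ∧ f 0 = 0}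
  zero_mem' := ⟨⟨0, LipschitzWith.const 0⟩, rfl⟩
  add_mem' := by
    rintro f g ⟨⟨C, hC⟩, hf⟩ ⟨⟨D, hD⟩, hg⟩
    exact ⟨⟨C + D, hC.add hD⟩, by simp [hf, hg]⟩
  smul_mem' := by
    rintro c f ⟨⟨C, hC⟩, hf⟩
    refine ⟨⟨‖c‖₊ * C, LipschitzWith.of_dist_le_mul fun x y => ?_⟩, by simp [hf]⟩
    have := hC.dist_le_mul x y
    simp only [Pi.smul_apply, dist_smul₀, NNReal.coe_mul, coe_nnnorm, mul_assoc]
    exact mul_le_mul_of_nonneg_left this (norm_nonneg c)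

/-- The space `Lip₀ⁿ(X, ℂ)`, `n ≥ 1`: it is `Lip₀(X, ℂ)`, to be normed by the Lipschitz constant of
the `n`-th amplification. -/
def LipZero (_n : ℕ+) (X : Type u) [NormedAddCommGroup X] : Type u := lipZero X

section LipZero

variable (n : ℕ+) (X : Type u) [NormedAddCommGroup X]

instance : AddCommGroup (LipZero n X) := inferInstanceAs (AddCommGroup (lipZero X))

instance : Module ℂ (LipZero n X) := inferInstanceAs (Module ℂ (lipZero X))

instance : FunLike (LipZero n X) X ℂ where
  coe f := f.1
  coe_injective := Subtype.val_injective

variable {n X}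

theorem LipZero.add_apply (f g : LipZero n X) (x : X) : (f + g) x = f x + g x := rfl

theorem LipZero.smul_apply (c : ℂ) (f : LipZero n X) (x : X) : (c • f) x = c * f x := rfl

theorem LipZero.lipschitz (f : LipZero n X) : ∃ C : ℝ≥0, LipschitzWith C f := f.2.1

theorem LipZero.map_zero (f : LipZero n X) : f 0 = 0 := f.2.2

/-- For `A, B ∈ M_n(X)`, the map `f ↦ f_n(A) - f_n(B) = [f(A_{ij}) - f(B_{ij})]` into
`M_n = B(ℂ^n)`. -/
def lipEval (p : Matrix (Fin n) (Fin n) X × Matrix (Fin n) (Fin n) X) :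
    LipZero n X →ₗ[ℂ] (EuclideanSpace ℂ (Fin n) →L[ℂ] EuclideanSpace ℂ (Fin n)) where
  toFun f := scalarOp (p.1.map f - p.2.map f)
  map_add' f g := by
    ext x i
    simp only [scalarOp_apply, LipZero.add_apply, Matrix.sub_apply, Matrix.map_apply, add_apply,
      PiLp.add_apply, ← Finset.sum_add_distrib]
    exact Finset.sum_congr rfl fun j _ => by ring
  map_smul' c f := by
    ext x i
    simp only [scalarOp_apply, LipZero.smul_apply, Matrix.sub_apply, Matrix.map_apply, smul_apply,
      PiLp.smul_apply, smul_eq_mul, Finset.mul_sum, RingHom.id_apply]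
    exact Finset.sum_congr rfl fun j _ => by ring

variable [NormedSpace ℂ X] [OperatorStructure X]

/-- The norm of `Lip₀ⁿ(X, ℂ)` is `Lip_n(f)`, the Lipschitz constant of the `n`-th amplification
`f_n : M_n(X) → M_n`. -/
instance : Norm (LipZero n X) where
  norm f := leastConst (fun p : Matrix (Fin n) (Fin n) X × Matrix (Fin n) (Fin n) X =>
    ‖lipEval p f‖) (fun p => mnorm n (p.1 - p.2))

theorem LipZero.exists_bound (f : LipZero n X) :
    ∃ C, ∀ p : Matrix (Fin n) (Fin n) X × Matrix (Fin n) (Fin n) X,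
      ‖lipEval p f‖ ≤ C * mnorm n (p.1 - p.2) := by
  obtain ⟨C, hC⟩ := f.lipschitz
  refine ⟨∑ _i : Fin n, ∑ _j : Fin n, (C : ℝ), fun p => ?_⟩
  refine (norm_scalarOp_le _).trans ?_
  simp only [Finset.sum_mul]
  refine Finset.sum_le_sum fun i _ => Finset.sum_le_sum fun j _ => ?_
  refine le_trans ?_ (mul_le_mul_of_nonneg_left (norm_entry_le_mnorm (p.1 - p.2) i j) C.2)
  rw [Matrix.sub_apply, Matrix.sub_apply, ← dist_eq_norm, ← dist_eq_norm]
  exact hC.dist_le_mul _ _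

theorem LipZero.norm_lipEval_le (f : LipZero n X)
    (p : Matrix (Fin n) (Fin n) X × Matrix (Fin n) (Fin n) X) :
    ‖lipEval p f‖ ≤ ‖f‖ * mnorm n (p.1 - p.2) :=
  le_leastConst_mul (fun _ => mnorm_nonneg _) f.exists_bound p

theorem LipZero.norm_le {f : LipZero n X} {C : ℝ} (hC : 0 ≤ C)
    (h : ∀ p, ‖lipEval p f‖ ≤ C * mnorm n (p.1 - p.2)) : ‖f‖ ≤ C :=
  leastConst_le hC h

theorem LipZero.norm_apply_le (f : LipZero n X) (x : X) :
    ‖f x‖ ≤ ‖f‖ * ∑ _i : Fin n, ∑ _j : Fin n, ‖x‖ := by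
  let A : Matrix (Fin n) (Fin n) X := Matrix.of fun _ _ => x
  have h1 := f.norm_lipEval_le (A, 0)
  have h2 : ‖(A.map f - (0 : Matrix (Fin n) (Fin n) X).map f) ⟨0, n.2⟩ ⟨0, n.2⟩‖ ≤ ‖lipEval (A, 0) f‖ :=
    norm_entry_le_scalarOp _ _ _
  have h3 : mnorm n (A - 0) ≤ ∑ _i : Fin n, ∑ _j : Fin n, ‖x‖ := by
    rw [sub_zero]
    exact mnorm_le_sum A
  have hf : 0 ≤ ‖f‖ := leastConst_nonneg
  have h4 : (A.map f - (0 : Matrix (Fin n) (Fin n) X).map f) ⟨0, n.2⟩ ⟨0, n.2⟩ = f x := by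
    rw [Matrix.sub_apply, Matrix.map_apply, Matrix.map_apply, Matrix.zero_apply, f.map_zero,
      sub_zero]
    rfl
  rw [h4] at h2
  exact h2.trans (h1.trans (mul_le_mul_of_nonneg_left h3 hf))

theorem LipZero.core : NormedSpace.Core ℂ (LipZero n X) where
  norm_nonneg f := leastConst_nonneg
  norm_triangle f g := by
    have hf : 0 ≤ ‖f‖ := leastConst_nonneg
    have hg : 0 ≤ ‖g‖ := leastConst_nonneg
    refine LipZero.norm_le (add_nonneg hf hg) fun p => ?_
    rw [map_add, add_mul]
    exact (norm_add_le _ _).trans (add_le_add (f.norm_lipEval_le p) (g.norm_lipEval_le p))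
  norm_smul c f := by
    have key : ∀ (c : ℂ) (f : LipZero n X), ‖c • f‖ ≤ ‖c‖ * ‖f‖ := by
      intro c f
      have hf : 0 ≤ ‖f‖ := leastConst_nonneg
      refine LipZero.norm_le (mul_nonneg (norm_nonneg c) hf) fun p => ?_
      rw [map_smul, norm_smul, mul_assoc]
      exact mul_le_mul_of_nonneg_left (f.norm_lipEval_le p) (norm_nonneg c)
    refine le_antisymm (key c f) ?_
    rcases eq_or_ne c 0 with rfl | hc
    · rw [norm_zero, zero_mul]
      exact leastConst_nonneg
    · have := key c⁻¹ (c • f)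
      rwa [smul_smul, inv_mul_cancel₀ hc, one_smul, norm_inv,
        le_inv_mul_iff₀ (norm_pos_iff.2 hc)] at this
  norm_eq_zero_iff f := by
    constructor
    · intro h
      refine DFunLike.ext _ _ fun x => ?_
      have := f.norm_apply_le x
      rw [h, zero_mul] at this
      exact norm_le_zero_iff.1 this
    · rintro rfl
      refine le_antisymm (LipZero.norm_le le_rfl fun p => ?_) leastConst_nonneg
      simp

instance : NormedAddCommGroup (LipZero n X) := NormedAddCommGroup.ofCore LipZero.core

instance : NormedSpace ℂ (LipZero n X) := NormedSpace.ofCore LipZero.core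

/-- The operator space structure of `Lip₀ⁿ(X, ℂ)`: the norm of `[f_{ml}] ∈ M_k(Lip₀(X, ℂ))` is
`Lip_n` of the map `[f_{ml}] : X → M_k`, i.e. the least `C ≥ 0` such that
`‖[f_{ml}(A_{ij}) - f_{ml}(B_{ij})]‖ ≤ C ‖A - B‖` for all `A, B ∈ M_n(X)`. The norm on the left is
that of `M_k(M_n) = M_{nk} = M_n(M_k)`. -/
instance lipZeroOperatorStructure : OperatorStructure (LipZero n X) where
  mnorm _ F := leastConst (fun p : Matrix (Fin n) (Fin n) X × Matrix (Fin n) (Fin n) X =>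
    ‖blockOp (F.map (lipEval p))‖) (fun p => mnorm n (p.1 - p.2))
  exists_rep := exists_rep_of_family
    (fun p : Matrix (Fin n) (Fin n) X × Matrix (Fin n) (Fin n) X => mnorm n (p.1 - p.2))
    (fun p => mnorm_nonneg (p.1 - p.2)) (fun p => lipEval p)
    (fun p f => LipZero.norm_lipEval_le f p)
    (fun _ _ hC h => LipZero.norm_le hC h)

end LipZero

section LipFree

variable (n : ℕ+) (X : Type u) [NormedAddCommGroup X] [NormedSpace ℂ X] [OperatorStructure X]

variable {X} in
/-- The evaluation functional `δ_x ∈ Lip₀ⁿ(X, ℂ)^*`, `δ_x(f) = f(x)`. -/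
def deltaMap (x : X) : StrongDual ℂ (LipZero n X) :=
  LinearMap.mkContinuous
    { toFun := fun f => f x
      map_add' := fun _ _ => rfl
      map_smul' := fun _ _ => rfl }
    (∑ _i : Fin n, ∑ _j : Fin n, ‖x‖) fun f => by
      rw [mul_comm]; exact f.norm_apply_le x

/-- The `n`-Lipschitz-free operator space `Fⁿ(X)`: the closed linear span of `{δ_x : x ∈ X}` in the
dual operator space `Lip₀ⁿ(X, ℂ)^*`. -/
def lipFree : Submodule ℂ (StrongDual ℂ (LipZero n X)) :=
  (Submodule.span ℂ (Set.range (deltaMap n : X → StrongDual ℂ (LipZero n X)))).topologicalClosure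

instance completeSpace_lipFree : CompleteSpace (lipFree n X) :=
  (Submodule.isClosed_topologicalClosure _).completeSpace_coe

end LipFree

/-! ### Embeddings -/

section embeddings

variable {X : Type u} {Y : Type v} [NormedAddCommGroup X] [NormedSpace ℂ X] [OperatorStructure X]
  [NormedAddCommGroup Y] [NormedSpace ℂ Y] [OperatorStructure Y]

/-- `f` is an `n`-isometry: the `n`-th amplification `f_n : M_n(X) → M_n(Y)` is an isometry. -/
def IsNIsometry (n : ℕ) (f : X → Y) : Prop :=
  ∀ A B : Matrix (Fin n) (Fin n) X, mnorm n (A.map f - B.map f) = mnorm n (A - B)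

/-- The `n`-th Lipschitz distortion `Dist_n(f)`: the infimum of all `D > 0` for which there is
`r > 0` with `r ‖A - B‖ ≤ ‖f_n(A) - f_n(B)‖ ≤ D r ‖A - B‖` for all `A, B ∈ M_n(X)`
(`∞` if there is no such `D`). -/
def distortion (n : ℕ) (f : X → Y) : ℝ≥0∞ :=
  ⨅ D ∈ {D : ℝ | 0 < D ∧ ∃ r > 0, ∀ A B : Matrix (Fin n) (Fin n) X,
    r * mnorm n (A - B) ≤ mnorm n (A.map f - B.map f) ∧
      mnorm n (A.map f - B.map f) ≤ D * r * mnorm n (A - B)}, ENNReal.ofReal D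

variable (X Y)

/-- `X` almost completely isometrically embeds into `Y`. -/
def AlmostCompletelyIsometricallyEmbeds : Prop :=
  ∃ f : ℕ+ → X → Y, ∀ n : ℕ+, IsNIsometry n (f n)

/-- `X` almost completely Lipschitzly embeds into `Y`. -/
def AlmostCompletelyLipschitzlyEmbeds : Prop :=
  ∃ f : ℕ+ → X → Y, ∃ D : ℝ, 0 < D ∧ ∀ n : ℕ+, distortion n (f n) ≤ ENNReal.ofReal D

/-- `X` almost completely `ℝ`-linearly isometrically embeds into `Y`. -/
def AlmostCompletelyRLinearlyIsometricallyEmbeds : Prop :=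
  ∃ f : ℕ+ → X →ₗ[ℝ] Y, ∀ n : ℕ+, IsNIsometry n (f n)

/-- `X` almost completely `ℝ`-isomorphically embeds into `Y`. -/
def AlmostCompletelyRIsomorphicallyEmbeds : Prop :=
  ∃ f : ℕ+ → X →ₗ[ℝ] Y, ∃ D : ℝ, 0 < D ∧ ∀ n : ℕ+, distortion n (f n) ≤ ENNReal.ofReal D

end embeddings

/-- `X` `ℝ`-isomorphically embeds into `Y`: there is a bounded `ℝ`-linear map `X → Y` which is
bounded below. -/
def RIsomorphicallyEmbeds (X : Type u) (Y : Type v) [NormedAddCommGroup X] [NormedSpace ℂ X]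
    [NormedAddCommGroup Y] [NormedSpace ℂ Y] : Prop :=
  ∃ T : X →L[ℝ] Y, ∃ c > 0, ∀ x, c * ‖x‖ ≤ ‖T x‖

/-- `X` is Hilbertian: it is linearly isomorphic, as a Banach space, to a Hilbert space. -/
def Hilbertian (X : Type u) [NormedAddCommGroup X] [NormedSpace ℂ X] : Prop :=
  ∃ (K : Type u) (_ : NormedAddCommGroup K) (_ : InnerProductSpace ℂ K) (_ : CompleteSpace K),
    Nonempty (X ≃L[ℂ] K)

end OperatorSpaces

end

noncomputable section

namespace OperatorSpaces

open OperatorStructure Filter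

/-! ### The canonical embeddings into the Lipschitz-free operator spaces -/

/-! The map `x ↦ δ_x` into `Fⁿ(X)` is an `n`-isometry (`mnorm_deltaMap_sub`). The upper estimate is
the definition of the norm of `Lip₀ⁿ`, once `M_n(M_k)` is identified with `M_k(M_n)`. For the lower
one, represent `X` in `B(K)`: compressions to finite-dimensional subspaces of `K` are matrices of
linear functionals of norm at most one in `M_k(Lip₀ⁿ)`, and they recover the norm. Following `δ` by
the inclusion of the `n`-th summand gives the almost complete isometric embedding.

The obstruction to linear embeddings is independent of the matrix norms. An orthonormal basis of a
nonseparable Hilbert space is an uncountable family on which every bounded real functional is small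
off a finite set, and a bounded `ℝ`-linear `T` transports this property. However, such a family in
`Fⁿ(X)` has only countably many nonzero members (`countable_ne_zero_of_mem_lipFree`). As `Y` has
countably many coordinates, `T` kills some basis vector and is not bounded below.

The countability claim rests on a gliding hump. Each element of `Fⁿ(X)` is carried by a countable
set. If no countable `E` carried all but countably many members, one could choose inductively
members and disjointly supported Lipschitz functions with a common constant, each function pairing
with its own member to at least one in modulus. Their sum is Lipschitz and pairs to at least one
with infinitely many members (`exists_countable_deltaSpan`). Thus one closed span `deltaSpan n E`
contains all but countably many members; it is separable, so countably many functionals detect its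
nonzero elements. -/

theorem norm_blockOp_scalarOp_swap_le {n k : ℕ} (c : Fin n → Fin n → Fin k → Fin k → ℂ) :
    ‖blockOp (Matrix.of fun i j => scalarOp (Matrix.of fun s t => c i j s t))‖ ≤
      ‖blockOp (Matrix.of fun s t => scalarOp (Matrix.of fun i j => c i j s t))‖ := by
  refine ContinuousLinearMap.opNorm_le_bound _ (norm_nonneg _) fun x => ?_
  -- Exchanging the two indices is a unitary that intertwines the two block operators.
  have hn : ∀ {a b : ℕ} (z : PiLp 2 (fun _ : Fin a => EuclideanSpace ℂ (Fin b))),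
      ‖(WithLp.toLp 2 fun s => WithLp.toLp 2 fun i => z i s :
        PiLp 2 (fun _ : Fin b => EuclideanSpace ℂ (Fin a)))‖ = ‖z‖ := by
    intro a b z
    rw [← sq_eq_sq₀ (norm_nonneg _) (norm_nonneg _), PiLp.norm_sq_eq_of_L2, PiLp.norm_sq_eq_of_L2]
    simp only [EuclideanSpace.norm_sq_eq]
    exact Finset.sum_comm
  rw [← hn x, ← hn (blockOp _ x)]
  refine le_of_eq_of_le (congrArg norm ?_) (ContinuousLinearMap.le_opNorm _ _)
  ext s i
  simp only [blockOp_apply, WithLp.ofLp_sum, Finset.sum_apply, scalarOp_apply, Matrix.of_apply]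
  exact Finset.sum_comm

/-- The canonical identification of `M_n(M_k)` with `M_k(M_n)` is isometric. -/
theorem norm_blockOp_scalarOp_swap {n k : ℕ} (c : Fin n → Fin n → Fin k → Fin k → ℂ) :
    ‖blockOp (Matrix.of fun i j => scalarOp (Matrix.of fun s t => c i j s t))‖ =
      ‖blockOp (Matrix.of fun s t => scalarOp (Matrix.of fun i j => c i j s t))‖ :=
  le_antisymm (norm_blockOp_scalarOp_swap_le c)
    (norm_blockOp_scalarOp_swap_le fun s t i j => c i j s t)

/-! ### Compressions to finite-dimensional subspaces -/

section compression

variable {E K : Type*} [NormedAddCommGroup E] [InnerProductSpace ℂ E]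
  [NormedAddCommGroup K] [InnerProductSpace ℂ K]

theorem norm_toLp_isometry {n : ℕ} (V : E →ₗᵢ[ℂ] K) (x : PiLp 2 (fun _ : Fin n => E)) :
    ‖(WithLp.toLp 2 fun i => V (x i) : PiLp 2 (fun _ : Fin n => K))‖ = ‖x‖ := by
  simp [PiLp.norm_eq_of_L2]

/-- This lets an operator be tested on a finite-dimensional corner containing a given vector
together with its image. -/
theorem exists_isometry_range {ι : Type*} [Finite ι] (x : ι → K) :
    ∃ (k : ℕ) (V : EuclideanSpace ℂ (Fin k) →ₗᵢ[ℂ] K), ∀ i, ∃ y, V y = x i := by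
  let U := Submodule.span ℂ (Set.range x)
  have : FiniteDimensional ℂ U := FiniteDimensional.span_of_finite ℂ (Set.finite_range x)
  let b := stdOrthonormalBasis ℂ U
  refine ⟨_, U.subtypeₗᵢ.comp b.repr.symm.toLinearIsometry, fun i => ?_⟩
  exact ⟨b.repr ⟨x i, Submodule.subset_span ⟨i, rfl⟩⟩, by simp⟩

variable [CompleteSpace E] [CompleteSpace K]

/-- The compression `V^* a V` of an operator `a` by an isometry `V`. -/
def compression (V : E →ₗᵢ[ℂ] K) (a : K →L[ℂ] K) : E →L[ℂ] E :=
  (ContinuousLinearMap.adjoint V.toContinuousLinearMap) ∘L a ∘L V.toContinuousLinearMap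

theorem adjoint_apply_isometry (V : E →ₗᵢ[ℂ] K) (x : E) :
    ContinuousLinearMap.adjoint V.toContinuousLinearMap (V x) = x := by
  refine ext_inner_left ℂ fun y => ?_
  rw [ContinuousLinearMap.adjoint_inner_right]
  exact V.inner_map_map y x

theorem norm_adjoint_isometry_apply_le (V : E →ₗᵢ[ℂ] K) (x : K) :
    ‖ContinuousLinearMap.adjoint V.toContinuousLinearMap x‖ ≤ ‖x‖ := by
  refine (ContinuousLinearMap.le_of_opNorm_le _ ?_ x).trans_eq (one_mul _)
  rw [LinearIsometryEquiv.norm_map]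
  exact V.norm_toContinuousLinearMap_le

theorem blockOp_compression_apply {n : ℕ} (V : E →ₗᵢ[ℂ] K) (D : Matrix (Fin n) (Fin n) (K →L[ℂ] K))
    (x : PiLp 2 (fun _ : Fin n => E)) (i : Fin n) :
    blockOp (D.map (compression V)) x i =
      ContinuousLinearMap.adjoint V.toContinuousLinearMap
        (blockOp D (WithLp.toLp 2 fun j => V (x j)) i) := by
  simp [blockOp_apply, compression]

/-- The compressed matrix is the original one between the contractions `V^{⊕n}` and `(V^*)^{⊕n}`. -/
theorem norm_blockOp_compression_le {n : ℕ} (V : E →ₗᵢ[ℂ] K)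
    (D : Matrix (Fin n) (Fin n) (K →L[ℂ] K)) :
    ‖blockOp (D.map (compression V))‖ ≤ ‖blockOp D‖ := by
  refine ContinuousLinearMap.opNorm_le_bound _ (norm_nonneg _) fun x => ?_
  rw [← norm_toLp_isometry V x]
  refine le_trans ?_ (ContinuousLinearMap.le_opNorm _ _)
  rw [← sq_le_sq₀ (norm_nonneg _) (norm_nonneg _), PiLp.norm_sq_eq_of_L2, PiLp.norm_sq_eq_of_L2]
  refine Finset.sum_le_sum fun i _ => ?_
  rw [blockOp_compression_apply]
  exact pow_le_pow_left₀ (norm_nonneg _) (norm_adjoint_isometry_apply_le V _) 2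

end compression

/-! ### The evaluation map is an `n`-isometry -/

section delta

variable {X : Type u} [NormedAddCommGroup X] [NormedSpace ℂ X]

/-- A continuous linear functional, as a Lipschitz function vanishing at `0`. -/
def LipZero.ofDual (n : ℕ+) (φ : StrongDual ℂ X) : LipZero n X :=
  ⟨φ, ⟨‖φ‖₊, φ.lipschitz⟩, _root_.map_zero φ⟩

variable [OperatorStructure X]

theorem deltaMap_apply (n : ℕ+) (x : X) (f : LipZero n X) : deltaMap n x f = f x := rfl

theorem map_dualEval_delta {n : ℕ+} {k : ℕ} (A B : Matrix (Fin n) (Fin n) X)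
    (F : Matrix (Fin k) (Fin k) (LipZero n X)) :
    (A.map (deltaMap n) - B.map (deltaMap n)).map (dualEval ⟨k, F⟩) =
      Matrix.of fun i j => scalarOp (Matrix.of fun s t => F s t (A i j) - F s t (B i j)) := rfl

theorem norm_blockOp_dualEval_delta {n : ℕ+} {k : ℕ} (A B : Matrix (Fin n) (Fin n) X)
    (F : Matrix (Fin k) (Fin k) (LipZero n X)) :
    ‖blockOp ((A.map (deltaMap n) - B.map (deltaMap n)).map (dualEval ⟨k, F⟩))‖ =
      ‖blockOp (F.map (lipEval (A, B)))‖ := by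
  rw [map_dualEval_delta]
  exact norm_blockOp_scalarOp_swap fun i j s t => F s t (A i j) - F s t (B i j)

theorem norm_blockOp_lipEval_le {n : ℕ+} {k : ℕ} (F : Matrix (Fin k) (Fin k) (LipZero n X))
    (p : Matrix (Fin n) (Fin n) X × Matrix (Fin n) (Fin n) X) :
    ‖blockOp (F.map (lipEval p))‖ ≤ mnorm k F * mnorm n (p.1 - p.2) := by
  refine le_leastConst_mul (a := fun p : Matrix (Fin n) (Fin n) X × Matrix (Fin n) (Fin n) X =>
    ‖blockOp (F.map (lipEval p))‖) (w := fun p => mnorm n (p.1 - p.2)) (fun _ => mnorm_nonneg _)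
    -- The least constant is itself a bound only when some bound exists; the sum of the entry norms
    -- is one.
    ⟨∑ s, ∑ t, ‖F s t‖, fun q => (norm_blockOp_le _).trans ?_⟩ p
  simp only [Finset.sum_mul]
  exact Finset.sum_le_sum fun s _ => Finset.sum_le_sum fun t _ => LipZero.norm_lipEval_le _ q

/-- Compressions of a representation, as matrices of Lipschitz functions. -/
theorem exists_matrix_lipZero (n : ℕ+) {K : Type*} [NormedAddCommGroup K] [InnerProductSpace ℂ K]
    [CompleteSpace K] (ρ : X →ₗᵢ[ℂ] (K →L[ℂ] K))
    (hρ : ∀ (m : ℕ) (A : Matrix (Fin m) (Fin m) X), mnorm m A = ‖blockOp (A.map ρ)‖)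
    {k : ℕ} (V : EuclideanSpace ℂ (Fin k) →ₗᵢ[ℂ] K) :
    ∃ F : Matrix (Fin k) (Fin k) (LipZero n X), mnorm k F ≤ 1 ∧
      ∀ A B : Matrix (Fin n) (Fin n) X,
        (A.map (deltaMap n) - B.map (deltaMap n)).map (dualEval ⟨k, F⟩) =
          ((A - B).map ρ).map (compression V) := by
  let φ : Fin k → Fin k → StrongDual ℂ X := fun s t =>
    (EuclideanSpace.proj s : EuclideanSpace ℂ (Fin k) →L[ℂ] ℂ) ∘L
      (ContinuousLinearMap.adjoint V.toContinuousLinearMap) ∘L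
      (ContinuousLinearMap.apply ℂ K (V (EuclideanSpace.single t 1))) ∘L
      ρ.toContinuousLinearMap
  have hφ : ∀ s t x, φ s t x = compression V (ρ x) (EuclideanSpace.single t 1) s :=
    fun s t x => rfl
  let F : Matrix (Fin k) (Fin k) (LipZero n X) := Matrix.of fun s t => LipZero.ofDual n (φ s t)
  have hop : ∀ a : EuclideanSpace ℂ (Fin k) →L[ℂ] EuclideanSpace ℂ (Fin k),
      scalarOp (Matrix.of fun s t => a (EuclideanSpace.single t 1) s) = a := by
    intro a
    ext x s
    have hx : x = ∑ t, x t • EuclideanSpace.single t (1 : ℂ) := by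
      ext r
      simp [Pi.single_apply]
    conv_rhs => rw [hx, map_sum]
    simp [scalarOp_apply, mul_comm]
  have hF : ∀ A B : Matrix (Fin n) (Fin n) X,
      (A.map (deltaMap n) - B.map (deltaMap n)).map (dualEval ⟨k, F⟩) =
          ((A - B).map ρ).map (compression V) := by
    intro A B
    rw [map_dualEval_delta]
    ext1 i j
    rw [Matrix.of_apply, Matrix.map_apply, Matrix.map_apply, ← hop (compression V _)]
    congr 2
    ext s t
    have : F s t (A i j) - F s t (B i j) = φ s t (A i j - B i j) := (map_sub (φ s t) _ _).symm
    rw [this, hφ]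
    rfl
  -- Pairing `F` with `(A, B)` gives a compression of the represented `A - B`, whose norm is at most
  -- that of `A - B`.
  refine ⟨F, leastConst_le zero_le_one fun p => ?_, hF⟩
  rw [one_mul, ← norm_blockOp_dualEval_delta, hF, hρ]
  exact norm_blockOp_compression_le V _

/-- The `n`-th amplification of `δ : X → Fⁿ(X)` is an isometry. -/
theorem mnorm_deltaMap_sub (n : ℕ+) (A B : Matrix (Fin n) (Fin n) X) :
    mnorm n (A.map (deltaMap n) - B.map (deltaMap n)) = mnorm n (A - B) := by
  have hle : ∀ e : Σ k : ℕ, Matrix (Fin k) (Fin k) (LipZero n X),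
      ‖blockOp ((A.map (deltaMap n) - B.map (deltaMap n)).map (dualEval e))‖ ≤
        mnorm n (A - B) * mnorm e.1 e.2 := by
    intro e
    rw [norm_blockOp_dualEval_delta, mul_comm]
    exact norm_blockOp_lipEval_le _ _
  refine le_antisymm (leastConst_le (mnorm_nonneg _) hle)
    (le_csInf ⟨mnorm n (A - B), mnorm_nonneg _, hle⟩ fun C hC => ?_)
  · obtain ⟨K, _, _, _, ρ, hρ⟩ := exists_rep (V := X)
    rw [hρ]
    refine ContinuousLinearMap.opNorm_le_bound _ hC.1 fun ξ => ?_
    set v := blockOp ((A - B).map ρ) ξ with hv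
    -- The range of `V` contains all coordinates of `ξ` and of its image `v`, so compressing by `V`
    -- loses nothing at `ξ`.
    obtain ⟨k, V, hV⟩ := exists_isometry_range (Sum.elim (fun i => v i) (fun i => ξ i))
    choose y hy using hV
    obtain ⟨F, hF1, hF⟩ := exists_matrix_lipZero n ρ hρ V
    have h1 := (hC.2 ⟨k, F⟩).trans (mul_le_of_le_one_right hC.1 hF1)
    beta_reduce at h1
    rw [hF] at h1
    let ξ' : PiLp 2 (fun _ : Fin n => EuclideanSpace ℂ (Fin k)) :=
      WithLp.toLp 2 fun i => y (Sum.inr i)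
    let v' : PiLp 2 (fun _ : Fin n => EuclideanSpace ℂ (Fin k)) :=
      WithLp.toLp 2 fun i => y (Sum.inl i)
    have hξ : (WithLp.toLp 2 fun i => V (ξ' i)) = ξ := by
      ext i
      exact hy (Sum.inr i)
    have hv' : (WithLp.toLp 2 fun i => V (v' i)) = v := by
      ext i
      exact hy (Sum.inl i)
    have h2 : blockOp (((A - B).map ρ).map (compression V)) ξ' = v' := by
      refine PiLp.ext fun i => ?_
      rw [blockOp_compression_apply, hξ, ← hv, ← hv']
      exact adjoint_apply_isometry V _
    have h3 := ContinuousLinearMap.le_of_opNorm_le _ h1 ξ'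
    rwa [h2, ← norm_toLp_isometry V, ← norm_toLp_isometry V, hξ, hv'] at h3

theorem deltaMap_mem_lipFree (n : ℕ+) (x : X) : deltaMap n x ∈ lipFree n X :=
  Submodule.le_topologicalClosure _ (Submodule.subset_span ⟨x, rfl⟩)

end delta

/-! ### Summands of a `c₀`-sum -/

section c0Single

variable {ι : Type v} [DecidableEq ι] (E : ι → Type u) [∀ i, NormedAddCommGroup (E i)]
  [∀ i, NormedSpace ℂ (E i)]

/-- The canonical inclusion of a summand in a `c₀`-sum. -/
def c0Single (i : ι) (x : E i) : c0Sum E :=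
  ⟨lp.single ∞ i x, by
    refine tendsto_const_nhds.congr' ?_
    have h : ∀ᶠ j in Filter.cofinite, j ≠ i := by simp
    filter_upwards [h] with j hj
    simp [Pi.single_eq_of_ne hj]⟩

theorem c0Single_apply_self (i : ι) (x : E i) : (c0Single E i x : lp E ∞) i = x := by
  simp [c0Single]

theorem c0Single_apply_of_ne {i j : ι} (h : j ≠ i) (x : E i) :
    (c0Single E i x : lp E ∞) j = 0 := by
  simp [c0Single, Pi.single_eq_of_ne h]

theorem mnorm_c0Single_sub [∀ i, OperatorStructure (E i)] {n : ℕ} (i : ι)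
    (A B : Matrix (Fin n) (Fin n) (E i)) :
    mnorm n (A.map (c0Single E i) - B.map (c0Single E i)) = mnorm n (A - B) := by
  have hi : (A.map (c0Single E i) - B.map (c0Single E i)).map
      (fun y => (y : lp E ∞) i) = A - B := by
    ext a b
    simp [c0Single_apply_self]
  have hj : ∀ j ≠ i, (A.map (c0Single E i) - B.map (c0Single E i)).map
      (fun y => (y : lp E ∞) j) = 0 := by
    intro j hj
    ext a b
    simp [c0Single_apply_of_ne E hj]
  have key : ∀ C, 0 ≤ C → ((∀ j, mnorm n ((A.map (c0Single E i) - B.map (c0Single E i)).map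
      (fun y => (y : lp E ∞) j)) ≤ C * 1) ↔ mnorm n (A - B) ≤ C) := by
    intro C hC
    refine ⟨fun h => by simpa [hi] using h i, fun h j => ?_⟩
    rcases eq_or_ne j i with rfl | hne
    · rwa [hi, mul_one]
    · rw [hj j hne, mul_one]
      exact (mnorm_le_sum _).trans (by simpa using hC)
  refine le_antisymm (leastConst_le (mnorm_nonneg _) ((key _ (mnorm_nonneg _)).2 le_rfl))
    (le_csInf ⟨_, mnorm_nonneg (A - B), (key _ (mnorm_nonneg _)).2 le_rfl⟩ fun C hC => ?_)
  exact (key C hC.1).1 hC.2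

end c0Single

theorem almostCompletelyIsometricallyEmbeds_c0Sum_lipFree (X : Type u) [NormedAddCommGroup X]
    [NormedSpace ℂ X] [OperatorStructure X] :
    AlmostCompletelyIsometricallyEmbeds X (c0Sum fun n : ℕ+ => lipFree n X) := by
  refine ⟨fun n x => c0Single (fun n : ℕ+ => lipFree n X) n ⟨deltaMap n x,
    deltaMap_mem_lipFree n x⟩, fun n A B => ?_⟩
  rw [← mnorm_deltaMap_sub n A B]
  exact mnorm_c0Single_sub (fun n : ℕ+ => lipFree n X) n
    (A.map fun x => ⟨deltaMap n x, deltaMap_mem_lipFree n x⟩)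
    (B.map fun x => ⟨deltaMap n x, deltaMap_mem_lipFree n x⟩)

/-! ### Weakly null families in Lipschitz-free operator spaces -/

/-- A truncation on `ℝ` which vanishes near `0`. -/
def softClamp (m : ℝ) (t : ℝ) : ℝ :=
  max (-m) (min m (t - max (-m⁻¹) (min m⁻¹ t)))

theorem lipschitzWith_clamp (c : ℝ) : LipschitzWith 1 fun t : ℝ => max (-c) (min c t) :=
  (LipschitzWith.id.const_min c).const_max (-c)

/-- Clipping is `1`-Lipschitz and the identity minus a clipping is `2`-Lipschitz. The constant does
not depend on `m`, so truncations of one function converge pointwise with a common Lipschitz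
constant. -/
theorem lipschitzWith_softClamp (m : ℝ) : LipschitzWith 2 (softClamp m) := by
  have h := (lipschitzWith_clamp m).comp (LipschitzWith.id.sub (lipschitzWith_clamp m⁻¹))
  norm_num at h
  exact h

theorem abs_softClamp_le {m : ℝ} (hm : 0 ≤ m) (t : ℝ) : |softClamp m t| ≤ m :=
  abs_le.2 ⟨le_max_left _ _, max_le (by linarith) (min_le_left _ _)⟩

theorem softClamp_eq_zero {m t : ℝ} (hm : 0 ≤ m) (ht : |t| ≤ m⁻¹) : softClamp m t = 0 := by
  obtain ⟨h1, h2⟩ := abs_le.1 ht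
  rw [softClamp, min_eq_right h2, max_eq_right h1, sub_self, min_eq_right hm,
    max_eq_right (by linarith)]

theorem abs_softClamp_sub_le {m t : ℝ} (hm : 0 ≤ m) (ht : |t| + m⁻¹ ≤ m) :
    |softClamp m t - t| ≤ m⁻¹ := by
  have hi : 0 ≤ m⁻¹ := inv_nonneg.2 hm
  have hc : |max (-m⁻¹) (min m⁻¹ t)| ≤ m⁻¹ :=
    abs_le.2 ⟨le_max_left _ _, max_le (by linarith) (min_le_left _ _)⟩
  -- The outer clipping is inactive here, so the error is exactly the inner clipping.
  obtain ⟨h1, h2⟩ := abs_le.1 ((abs_sub t _).trans ((add_le_add_right hc |t|).trans ht))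
  rw [softClamp, min_eq_right h2, max_eq_right h1]
  simpa using hc

theorem tendsto_softClamp (t : ℝ) : Tendsto (fun k : ℕ => softClamp (k + 1) t) atTop (𝓝 t) := by
  rw [tendsto_iff_norm_sub_tendsto_zero]
  refine squeeze_zero' (Eventually.of_forall fun k => norm_nonneg _) ?_
    tendsto_one_div_add_atTop_nhds_zero_nat
  obtain ⟨N, hN⟩ := exists_nat_ge |t|
  filter_upwards [eventually_ge_atTop N] with k hk
  rw [one_div]
  refine abs_softClamp_sub_le (by positivity) ?_
  have h1 : (N : ℝ) ≤ k := by exact_mod_cast hk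
  have h2 : ((k : ℝ) + 1)⁻¹ ≤ 1 := inv_le_one_of_one_le₀ (by linarith [k.cast_nonneg (α := ℝ)])
  linarith

/-- A truncation on `ℂ` which vanishes near `0`. -/
def complexSoftClamp (m : ℝ) (z : ℂ) : ℂ := ⟨softClamp m z.re, softClamp m z.im⟩

/-- The constant is `2 + 2`, from the real and imaginary parts. -/
theorem lipschitzWith_complexSoftClamp (m : ℝ) : LipschitzWith 4 (complexSoftClamp m) := by
  refine LipschitzWith.of_dist_le_mul fun z w => ?_
  rw [dist_eq_norm, dist_eq_norm]
  refine (Complex.norm_le_abs_re_add_abs_im _).trans ?_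
  have h1 := (lipschitzWith_softClamp m).dist_le_mul z.re w.re
  have h2 := (lipschitzWith_softClamp m).dist_le_mul z.im w.im
  have h3 := Complex.abs_re_le_norm (z - w)
  have h4 := Complex.abs_im_le_norm (z - w)
  simp only [Real.dist_eq, complexSoftClamp, Complex.sub_re, Complex.sub_im] at *
  push_cast at *
  linarith

theorem norm_complexSoftClamp_le {m : ℝ} (hm : 0 ≤ m) (z : ℂ) : ‖complexSoftClamp m z‖ ≤ 2 * m := by
  refine (Complex.norm_le_abs_re_add_abs_im _).trans ?_
  have h1 := abs_softClamp_le hm z.re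
  have h2 := abs_softClamp_le hm z.im
  simp only [complexSoftClamp]
  linarith

theorem complexSoftClamp_eq_zero {m : ℝ} {z : ℂ} (hm : 0 ≤ m) (hz : ‖z‖ ≤ m⁻¹) :
    complexSoftClamp m z = 0 :=
  Complex.ext (softClamp_eq_zero hm ((Complex.abs_re_le_norm z).trans hz))
    (softClamp_eq_zero hm ((Complex.abs_im_le_norm z).trans hz))

theorem tendsto_complexSoftClamp (z : ℂ) :
    Tendsto (fun k : ℕ => complexSoftClamp (k + 1) z) atTop (𝓝 z) := by
  have h := (Complex.continuous_ofReal.tendsto _).comp (tendsto_softClamp z.re)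
  have h' := (Complex.continuous_ofReal.tendsto _).comp (tendsto_softClamp z.im)
  have := h.add (h'.mul_const Complex.I)
  rw [Complex.re_add_im] at this
  refine this.congr fun k => ?_
  exact Complex.ext (by simp [complexSoftClamp]) (by simp [complexSoftClamp])

/-! ### Supports, pointwise continuity and separation in `Fⁿ(X)` -/

section lipFree

variable {n : ℕ+} {X : Type u} [NormedAddCommGroup X]

/-- The element of `Lip₀ⁿ(X, ℂ)` given by a Lipschitz function. -/
def LipZero.mk (n : ℕ+) (f : X → ℂ) {L : ℝ≥0} (hf : LipschitzWith L f) (h0 : f 0 = 0) :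
    LipZero n X := ⟨f, ⟨L, hf⟩, h0⟩

variable [NormedSpace ℂ X] [OperatorStructure X]

/-- Estimating a matrix by its entries costs a factor `n²`, harmless for fixed `n`: boundedness in
`Lip₀ⁿ` needs only a scalar Lipschitz bound. -/
theorem LipZero.norm_le_of_lipschitzWith (f : LipZero n X) {C : ℝ≥0} (hC : LipschitzWith C f) :
    ‖f‖ ≤ ∑ _i : Fin n, ∑ _j : Fin n, (C : ℝ) := by
  refine LipZero.norm_le (by positivity) fun p => (norm_scalarOp_le _).trans ?_
  simp only [Finset.sum_mul]
  refine Finset.sum_le_sum fun i _ => Finset.sum_le_sum fun j _ => ?_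
  refine le_trans ?_ (mul_le_mul_of_nonneg_left (norm_entry_le_mnorm (p.1 - p.2) i j) C.2)
  rw [Matrix.sub_apply, Matrix.sub_apply, ← dist_eq_norm, ← dist_eq_norm]
  exact hC.dist_le_mul _ _

variable (n) in
/-- The closed linear span of the evaluations at the points of `E`. -/
def deltaSpan (E : Set X) : Submodule ℂ (StrongDual ℂ (LipZero n X)) :=
  (Submodule.span ℂ (deltaMap n '' E)).topologicalClosure

theorem deltaSpan_mono {E F : Set X} (h : E ⊆ F) : deltaSpan n E ≤ deltaSpan n F :=
  Submodule.topologicalClosure_mono (Submodule.span_mono (Set.image_mono h))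

/-- The kernel of evaluation at `f` is closed and contains the generators. Consequently `μ f`
depends only on the restriction of `f` to `E`. -/
theorem apply_eq_zero_of_mem_deltaSpan {E : Set X} {μ : StrongDual ℂ (LipZero n X)}
    (hμ : μ ∈ deltaSpan n E) {f : LipZero n X} (hf : ∀ x ∈ E, f x = 0) : μ f = 0 := by
  have h : deltaSpan n E ≤ (ContinuousLinearMap.apply ℂ ℂ f).ker := by
    refine Submodule.topologicalClosure_minimal _ (Submodule.span_le.2 ?_)
      (ContinuousLinearMap.isClosed_ker _)
    rintro _ ⟨x, hx, rfl⟩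
    exact hf x hx
  exact h hμ

/-- An element of the closure is the limit of a sequence of finite combinations; collect their
points. -/
theorem exists_countable_mem_deltaSpan {μ : StrongDual ℂ (LipZero n X)} (hμ : μ ∈ lipFree n X) :
    ∃ C : Set X, C.Countable ∧ μ ∈ deltaSpan n C := by
  obtain ⟨ν, hν, hlim⟩ := mem_closure_iff_seq_limit.1 hμ
  classical
  have h : ∀ k, ∃ C : Finset X, ν k ∈ Submodule.span ℂ (deltaMap n '' (C : Set X)) := by
    intro k
    obtain ⟨T, hT, hk⟩ := Submodule.mem_span_finite_of_mem_span (hν k)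
    rw [← Set.image_univ, Finset.subset_set_image_iff] at hT
    obtain ⟨C, -, rfl⟩ := hT
    refine ⟨C, ?_⟩
    rwa [Finset.coe_image] at hk
  choose C hC using h
  refine ⟨⋃ k, C k, Set.countable_iUnion fun k => (C k).countable_toSet, ?_⟩
  exact mem_closure_of_tendsto hlim (Eventually.of_forall fun k =>
    Submodule.span_mono (Set.image_mono (Set.subset_iUnion (fun k => (C k : Set X)) k)) (hC k))

/-- Convergence is clear for finite combinations of evaluations, and passes to norm limits because
the `g m - f` are bounded in `Lip₀ⁿ`. -/
theorem tendsto_apply_of_mem_lipFree {μ : StrongDual ℂ (LipZero n X)} (hμ : μ ∈ lipFree n X)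
    {g : ℕ → LipZero n X} {f : LipZero n X} {L : ℝ≥0} (hL : ∀ m, LipschitzWith L (g m))
    (hg : ∀ x, Tendsto (fun m => g m x) atTop (𝓝 (f x))) :
    Tendsto (fun m => μ (g m)) atTop (𝓝 (μ f)) := by
  set B : ℝ := (∑ _i : Fin n, ∑ _j : Fin n, (L : ℝ)) + ‖f‖ with hB
  have hB0 : 0 ≤ B := by positivity
  have hgB : ∀ m, ‖g m - f‖ ≤ B := fun m =>
    (norm_sub_le _ _).trans (add_le_add_left ((g m).norm_le_of_lipschitzWith (hL m)) _)
  have hspan : ∀ ν ∈ Submodule.span ℂ (Set.range (deltaMap n : X → StrongDual ℂ (LipZero n X))),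
      Tendsto (fun m => ν (g m - f)) atTop (𝓝 0) := by
    intro ν hν
    induction hν using Submodule.span_induction with
    | mem ν h =>
      obtain ⟨x, rfl⟩ := h
      simpa [map_sub, deltaMap_apply] using (hg x).sub_const (f x)
    | zero => simp
    | add ν ν' _ _ h h' => simpa using h.add h'
    | smul c ν _ h => simpa using h.const_mul c
  rw [tendsto_iff_norm_sub_tendsto_zero, Metric.tendsto_atTop]
  intro ε hε
  obtain ⟨ν, hν, hνμ⟩ := Metric.mem_closure_iff.1 hμ (ε / (2 * (B + 1))) (by positivity)
  obtain ⟨N, hN⟩ := Metric.tendsto_atTop.1 (hspan ν hν) (ε / 2) (by positivity)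
  refine ⟨N, fun m hm => ?_⟩
  have h1 := hN m hm
  rw [dist_zero_right] at h1
  rw [dist_zero_right, norm_norm, ← map_sub]
  have h2 : ‖(μ - ν) (g m - f)‖ ≤ ε / 2 := by
    refine ((μ - ν).le_opNorm_of_le (hgB m)).trans ?_
    rw [dist_eq_norm] at hνμ
    refine (mul_le_mul hνμ.le (by linarith : B ≤ B + 1) hB0 (by positivity)).trans_eq ?_
    field_simp
  calc ‖μ (g m - f)‖ = ‖(μ - ν) (g m - f) + ν (g m - f)‖ := by simp
    _ ≤ _ := norm_add_le _ _
    _ < ε := by linarith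

/-- Apply the `n`-isometry to the matrices with all `n²` entries equal to `x`, respectively `y`. -/
theorem lipschitzWith_deltaMap :
    LipschitzWith (n * n) (deltaMap n : X → StrongDual ℂ (LipZero n X)) := by
  refine LipschitzWith.of_dist_le_mul fun x y => ?_
  have h := norm_entry_le_mnorm ((Matrix.of fun _ _ : Fin n => x).map (deltaMap n) -
    (Matrix.of fun _ _ : Fin n => y).map (deltaMap n)) ⟨0, n.2⟩ ⟨0, n.2⟩
  rw [mnorm_deltaMap_sub] at h
  rw [dist_eq_norm, dist_eq_norm]
  refine h.trans ((mnorm_le_sum _).trans_eq ?_)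
  simp [mul_assoc]

/-- Hahn–Banach separation by a Lipschitz function. -/
theorem exists_lipZero_of_notMem_deltaSpan {E : Set X} {μ : StrongDual ℂ (LipZero n X)}
    (hμ : μ ∈ lipFree n X) (hE : μ ∉ deltaSpan n E) :
    ∃ f : LipZero n X, (∀ x ∈ E, f x = 0) ∧ μ f ≠ 0 := by
  have : IsClosed (deltaSpan n E : Set (StrongDual ℂ (LipZero n X))) :=
    Submodule.isClosed_topologicalClosure _
  obtain ⟨φ, hφμ, hφ⟩ : ∃ φ : StrongDual ℂ (StrongDual ℂ (LipZero n X)), φ μ ≠ 0 ∧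
      ∀ ν ∈ deltaSpan n E, φ ν = 0 := by
    -- Hahn–Banach in the quotient by the closed subspace `deltaSpan n E`.
    have hne : ‖(deltaSpan n E).mkQL μ‖ ≠ 0 := by
      refine (norm_ne_zero_iff (E := StrongDual ℂ (LipZero n X) ⧸ deltaSpan n E)).2 ?_
      simpa using hE
    obtain ⟨ψ, -, hψ⟩ := exists_dual_vector'' ℂ ((deltaSpan n E).mkQL μ)
    refine ⟨ψ ∘L (deltaSpan n E).mkQL, ?_, fun ν hν => ?_⟩
    · rw [ContinuousLinearMap.comp_apply, hψ]
      exact Complex.ofReal_ne_zero.2 hne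
    · have : (deltaSpan n E).mkQL ν = 0 := by simpa using hν
      rw [ContinuousLinearMap.comp_apply, this, map_zero]
  -- Restricting `φ` to the evaluations gives a Lipschitz function, and evaluation at it agrees with
  -- `φ` on all of `Fⁿ(X)`, because it does on the generators.
  let f : LipZero n X := LipZero.mk n (fun x => φ (deltaMap n x))
    (φ.lipschitz.comp lipschitzWith_deltaMap) (by
    have : deltaMap n (0 : X) = 0 := by
      ext g
      exact g.map_zero
    rw [this, map_zero])
  have hf : ∀ ν ∈ lipFree n X, ν f = φ ν := by
    have h : lipFree n X ≤ (ContinuousLinearMap.apply ℂ ℂ f - φ).ker := by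
      refine Submodule.topologicalClosure_minimal _ (Submodule.span_le.2 ?_)
        (ContinuousLinearMap.isClosed_ker _)
      rintro _ ⟨x, rfl⟩
      have : deltaMap n x f = φ (deltaMap n x) := rfl
      simp [this]
    intro ν hν
    have := h hν
    simpa [sub_eq_zero] using this
  refine ⟨f, fun x hx => hφ _ ?_, by rwa [hf μ hμ]⟩
  exact Submodule.le_topologicalClosure _ (Submodule.subset_span ⟨x, hx, rfl⟩)

end lipFree

/-! ### Gluing and localizing Lipschitz functions -/

section disjoint

/-- A pointwise sum of disjointly supported `L`-Lipschitz functions is `2L`-Lipschitz. -/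
theorem lipschitzWith_tsum_of_disjoint {X : Type*} [PseudoMetricSpace X] {L : ℝ≥0}
    {f : ℕ → X → ℂ} (hf : ∀ k, LipschitzWith L (f k))
    (hd : ∀ j k x, j < k → f j x ≠ 0 → f k x = 0) :
    LipschitzWith (2 * L) fun x => ∑' k, f k x := by
  have hd' : ∀ j k x, j ≠ k → f j x ≠ 0 → f k x = 0 := by
    intro j k x hjk hj
    rcases lt_or_gt_of_ne hjk with h | h
    · exact hd j k x h hj
    · by_contra hk
      exact hj (hd k j x h hk)
  have hs : ∀ j x, f j x ≠ 0 → ∑' k, f k x = f j x := fun j x hj =>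
    tsum_eq_single j fun k hk => hd' j k x hk.symm hj
  have key : ∀ j x y, f j x ≠ 0 → ‖f j x - ∑' k, f k y‖ ≤ 2 * L * dist x y := by
    intro j x y hj
    have h1 : ∀ i, ‖f i x - f i y‖ ≤ L * dist x y := fun i => by
      rw [← dist_eq_norm]
      exact (hf i).dist_le_mul x y
    have h0 : 0 ≤ L * dist x y := by positivity
    by_cases hy : ∀ k, f k y = 0
    · have h2 := h1 j
      rw [hy j] at h2
      simp only [hy, tsum_zero]
      linarith
    · push Not at hy
      obtain ⟨k, hk⟩ := hy
      rw [hs k y hk]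
      rcases eq_or_ne j k with rfl | hjk
      · linarith [h1 j]
      -- Here `f j` vanishes at `y` and `f k` at `x`, so both values are at most `L * dist x y`;
      -- this is the source of the factor `2`.
      · have h2 := h1 j
        have h3 := h1 k
        rw [hd' k j y hjk.symm hk, sub_zero] at h2
        rw [hd' j k x hjk hj, zero_sub, norm_neg] at h3
        linarith [norm_sub_le (f j x) (f k y)]
  refine LipschitzWith.of_dist_le_mul fun x y => ?_
  rw [dist_eq_norm, NNReal.coe_mul, NNReal.coe_ofNat]
  by_cases hx : ∀ k, f k x = 0
  · by_cases hy : ∀ k, f k y = 0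
    · simp only [hx, hy, tsum_zero, sub_zero, norm_zero]
      positivity
    · push Not at hy
      obtain ⟨k, hk⟩ := hy
      have := key k y x hk
      rwa [← hs k y hk, norm_sub_rev, dist_comm] at this
  · push Not at hx
    obtain ⟨j, hj⟩ := hx
    have := key j x y hj
    rwa [← hs j x hj] at this

/-- Localization of a bounded Lipschitz function near a set. -/
theorem exists_lipschitzWith_localization {X : Type*} [PseudoMetricSpace X] {f : X → ℂ} {L : ℝ≥0}
    (hf : LipschitzWith L f) (hb : ∀ x, ‖f x‖ ≤ L) {δ : ℝ≥0} (hδ : 0 < δ) {C : Set X}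
    (hC : C.Nonempty) :
    ∃ g : X → ℂ, LipschitzWith (L + L * δ⁻¹) g ∧ (∀ x ∈ C, g x = f x) ∧
      (∀ x, f x = 0 → g x = 0) ∧ ∀ x, g x ≠ 0 → ∃ c ∈ C, dist x c < δ := by
  -- A cutoff equal to `1` on `C` and to `0` at distance at least `δ`. It is `δ⁻¹`-Lipschitz, so the
  -- product rule with `‖f‖ ≤ L` gives the constant `L + L * δ⁻¹`.
  let h : X → ℝ := fun x => max 0 (1 - (δ⁻¹ : ℝ≥0) * Metric.infDist x C)
  have h0 : ∀ x, 0 ≤ h x := fun x => le_max_left _ _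
  have h1 : ∀ x, h x ≤ 1 := fun x => by
    have : 0 ≤ ((δ⁻¹ : ℝ≥0) : ℝ) * Metric.infDist x C :=
      mul_nonneg (δ⁻¹).2 Metric.infDist_nonneg
    exact max_le zero_le_one (by linarith)
  have hL : ∀ x y, |h x - h y| ≤ (δ⁻¹ : ℝ≥0) * dist x y := by
    intro x y
    refine (abs_max_sub_max_le_max _ _ _ _).trans (max_le (by simp; positivity) ?_)
    have h2 := (Metric.lipschitz_infDist_pt C).dist_le_mul y x
    rw [Real.dist_eq, NNReal.coe_one, one_mul, dist_comm] at h2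
    rw [sub_sub_sub_cancel_left, ← mul_sub, abs_mul, NNReal.abs_eq]
    exact mul_le_mul_of_nonneg_left h2 (δ⁻¹).2
  refine ⟨fun x => f x * h x, ?_, fun x hx => ?_, fun x hx => by simp [hx], fun x hx => ?_⟩
  · refine LipschitzWith.of_dist_le_mul fun x y => ?_
    have h2 := hf.dist_le_mul x y
    rw [dist_eq_norm] at h2 ⊢
    have h3 : f x * h x - f y * h y = (f x - f y) * h x + f y * ((h x - h y : ℝ) : ℂ) := by
      push_cast; ring
    rw [h3]
    refine (norm_add_le _ _).trans ?_
    rw [norm_mul, norm_mul, Complex.norm_real, Complex.norm_real, Real.norm_of_nonneg (h0 x),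
      Real.norm_eq_abs]
    push_cast
    rw [add_mul]
    refine add_le_add ?_ ?_
    · exact (mul_le_of_le_one_right (norm_nonneg _) (h1 x)).trans h2
    · rw [mul_assoc]
      have h4 := hL x y
      push_cast at h4
      exact mul_le_mul (hb y) h4 (abs_nonneg _) L.2
  · simp [h, Metric.infDist_zero_of_mem hx]
  · rw [← Metric.infDist_lt_iff hC]
    by_contra! hle
    refine hx ?_
    have hδ' : (0 : ℝ) < δ := hδ
    have h2 : (1 : ℝ) ≤ (δ : ℝ)⁻¹ * Metric.infDist x C := by
      rw [le_inv_mul_iff₀ hδ']; simpa using hle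
    have h3 : h x = 0 := max_eq_left (by push_cast; linarith)
    simp [h3]

end disjoint

/-! ### The gliding hump and countability -/

section

variable {n : ℕ+} {X : Type u} [NormedAddCommGroup X] [NormedSpace ℂ X] [OperatorStructure X]

/-- `f` witnesses quantitatively that `μ` is not carried by a neighbourhood of `E`. -/
def IsSeparating (n : ℕ+) (N : ℕ) (E : Set X) (μ : StrongDual ℂ (LipZero n X)) : Prop :=
  ∃ f : LipZero n X, LipschitzWith N f ∧ (∀ x, ‖f x‖ ≤ N) ∧
    (∀ x, ∀ e ∈ E, dist x e * (N + 1) ≤ 1 → f x = 0) ∧ 1 ≤ ‖μ f‖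

theorem IsSeparating.anti {N : ℕ} {E F : Set X} (hEF : E ⊆ F)
    {μ : StrongDual ℂ (LipZero n X)} (h : IsSeparating n N F μ) : IsSeparating n N E μ := by
  obtain ⟨f, h1, h2, h3, h4⟩ := h
  exact ⟨f, h1, h2, fun x e he => h3 x e (hEF he), h4⟩

/-- Truncating a separating function makes it bounded and zero near `E`; by pointwise continuity
some truncation still pairs nontrivially with `μ`, and a multiple of it pairs to at least one. A
single integer controls all the data, so that countably many cases suffice. -/
theorem exists_isSeparating {E : Set X} {μ : StrongDual ℂ (LipZero n X)}
    (hμ : μ ∈ lipFree n X) (hE : μ ∉ deltaSpan n E) : ∃ N, IsSeparating n N E μ := by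
  obtain ⟨f, hf, hμf⟩ := exists_lipZero_of_notMem_deltaSpan hμ hE
  obtain ⟨L, hL⟩ := f.lipschitz
  have h00 : ∀ m : ℕ, complexSoftClamp (m + 1) 0 = 0 := fun m =>
    complexSoftClamp_eq_zero (by positivity) (by simp; positivity)
  let g : ℕ → LipZero n X := fun m => LipZero.mk n (fun x => complexSoftClamp (m + 1) (f x))
    ((lipschitzWith_complexSoftClamp _).comp hL) (by rw [f.map_zero, h00])
  have hlim := tendsto_apply_of_mem_lipFree hμ (g := g) (f := f)
    (fun m => (lipschitzWith_complexSoftClamp _).comp hL) fun x => tendsto_complexSoftClamp (f x)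
  obtain ⟨m, hm⟩ := (hlim.eventually_ne hμf).exists
  obtain ⟨k, hk⟩ := exists_nat_ge (1 / ‖μ (g m)‖)
  obtain ⟨l, hl⟩ := exists_nat_ge L
  rw [div_le_iff₀ (norm_pos_iff.2 hm)] at hk
  -- The summands serve the Lipschitz constant, the supremum bound and the vanishing radius: within
  -- `1 / (N + 1)` of `E` one has `‖f x‖ ≤ 1 / (m + 1)`.
  let N : ℕ := k * (4 * l) + k * (2 * (m + 1)) + l * (m + 1)
  have hval : ∀ x, ((k : ℂ) • g m) x = k * complexSoftClamp (m + 1) (f x) := fun x => rfl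
  refine ⟨N, (k : ℂ) • g m, ?_, fun x => ?_, fun x e he hxe => ?_, ?_⟩
  · refine LipschitzWith.of_dist_le_mul fun x y => ?_
    have h1 := ((lipschitzWith_complexSoftClamp (m + 1)).comp hL).dist_le_mul x y
    rw [dist_eq_norm] at h1 ⊢
    rw [hval, hval, ← mul_sub, norm_mul, Complex.norm_natCast]
    refine (mul_le_mul_of_nonneg_left h1 (by positivity)).trans ?_
    rw [← mul_assoc]
    refine mul_le_mul_of_nonneg_right ?_ dist_nonneg
    have hl' : (L : ℝ) ≤ l := by exact_mod_cast hl
    have h2 : (k : ℝ) * (4 * L) ≤ k * (4 * l) := by gcongr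
    have h3 : (0 : ℝ) ≤ k * (2 * (m + 1)) + l * (m + 1) := by positivity
    simp only [N]
    push_cast
    linarith
  · rw [hval, norm_mul, Complex.norm_natCast]
    have h1 := norm_complexSoftClamp_le (m := (m : ℝ) + 1) (by positivity) (f x)
    refine (mul_le_mul_of_nonneg_left h1 (by positivity)).trans ?_
    have h3 : (0 : ℝ) ≤ k * (4 * l) + l * (m + 1) := by positivity
    simp only [N]
    push_cast
    linarith
  · rw [hval, complexSoftClamp_eq_zero (by positivity), mul_zero]
    have h1 := hL.dist_le_mul x e
    rw [hf e he, dist_zero_right] at h1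
    refine h1.trans ?_
    rw [← one_div, le_div_iff₀ (by positivity)]
    refine le_trans ?_ hxe
    rw [mul_right_comm, mul_comm]
    refine mul_le_mul_of_nonneg_left ?_ dist_nonneg
    have hl' : (L : ℝ) ≤ l := by exact_mod_cast hl
    have h2 : (L : ℝ) * (m + 1) ≤ l * (m + 1) := by gcongr
    have h3 : (0 : ℝ) ≤ k * (4 * l) + k * (2 * (m + 1)) := by positivity
    simp only [N]
    push_cast
    linarith
  · rw [map_smul, norm_smul, Complex.norm_natCast]
    exact hk

/-- A family which is weakly null along the cofinite filter is, up to countably many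
members, carried by a countable set. -/
theorem exists_countable_deltaSpan {ι : Type*} {x : ι → StrongDual ℂ (LipZero n X)}
    (hx : ∀ i, x i ∈ lipFree n X) (hfin : ∀ f : LipZero n X, ∀ ε > 0, {i | ε ≤ ‖x i f‖}.Finite) :
    ∃ E : Set X, E.Countable ∧ {i | x i ∉ deltaSpan n E}.Countable := by
  by_contra! hcon
  -- If each `N` failed for some countable `E N`, the union of these sets would carry all but
  -- countably many members.
  obtain ⟨N, hN⟩ : ∃ N, ∀ E : Set X, E.Countable → ¬ {i | IsSeparating n N E (x i)}.Countable := by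
    by_contra! h
    choose E hE hEc using h
    refine hcon (⋃ N, E N) (Set.countable_iUnion hE) ((Set.countable_iUnion hEc).mono fun i hi => ?_)
    obtain ⟨N, hN⟩ := exists_isSeparating (hx i) hi
    exact Set.mem_iUnion.2 ⟨N, hN.anti (Set.subset_iUnion E N)⟩
  have hcount : ∀ f : LipZero n X, {i | x i f ≠ 0}.Countable := by
    intro f
    refine (Set.countable_iUnion fun k : ℕ =>
      (hfin f (1 / (k + 1)) (by positivity)).countable).mono fun i hi => ?_
    obtain ⟨k, hk⟩ := exists_nat_one_div_lt (norm_pos_iff.2 hi)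
    exact Set.mem_iUnion.2 ⟨k, hk.le⟩
  choose S hSc hS using fun i => exists_countable_mem_deltaSpan (hx i)
  -- The point `0` only makes the set nonempty, as localization requires.
  let C : ι → Set X := fun i => insert 0 (S i)
  have hCc : ∀ i, (C i).Countable := fun i => (hSc i).insert 0
  have hC : ∀ i, x i ∈ deltaSpan n (C i) := fun i => deltaSpan_mono (Set.subset_insert _ _) (hS i)
  let δ : ℝ≥0 := (N + 1)⁻¹
  have hδ : 0 < δ := by positivity
  let L : ℝ≥0 := N + N * δ⁻¹
  let P : ι × LipZero n X → Prop := fun d => LipschitzWith L d.2 ∧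
    (∀ y, d.2 y ≠ 0 → ∃ c ∈ C d.1, dist y c < δ) ∧ 1 ≤ ‖x d.1 d.2‖
  -- For `d` chosen before `e`: the later member annihilates the earlier function, and the later
  -- function vanishes near the earlier carrier.
  let r : ι × LipZero n X → ι × LipZero n X → Prop := fun d e =>
    x e.1 d.2 = 0 ∧ ∀ y, ∀ c ∈ C d.1, dist y c ≤ δ → e.2 y = 0
  obtain ⟨d, hd, hr⟩ := exists_seq_of_forall_finset_exists P r (by
    intro s _
    have h1 : (⋃ e ∈ s, C e.1).Countable := s.countable_toSet.biUnion fun e _ => hCc e.1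
    have h2 : (⋃ e ∈ s, {i | x i e.2 ≠ 0}).Countable :=
      s.countable_toSet.biUnion fun e _ => hcount e.2
    -- Uncountably many members are separated from the earlier carriers, while only countably many
    -- see an earlier function.
    obtain ⟨i, ⟨f, hf1, hf2, hf3, hf4⟩, hi⟩ : ∃ i, IsSeparating n N (⋃ e ∈ s, C e.1) (x i) ∧
        i ∉ ⋃ e ∈ s, {i | x i e.2 ≠ 0} := by
      by_contra! h
      exact hN _ h1 (h2.mono h)
    obtain ⟨g, hg1, hg2, hg3, hg4⟩ := exists_lipschitzWith_localization hf1
      (by simpa using hf2) hδ (C := C i) ⟨0, Set.mem_insert _ _⟩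
    let G : LipZero n X := LipZero.mk n g hg1 (hg3 0 f.map_zero)
    -- Localizing does not change the pairing, since `G = f` on the carrier of `x i`.
    have hG : x i G = x i f := by
      rw [← sub_eq_zero, ← map_sub]
      refine apply_eq_zero_of_mem_deltaSpan (hC i) fun y hy => ?_
      exact sub_eq_zero.2 (hg2 y hy)
    refine ⟨(i, G), ⟨hg1, hg4, by rwa [hG]⟩, fun e he => ⟨?_, fun y c hc hyc => hg3 y ?_⟩⟩
    · by_contra h
      exact hi (Set.mem_biUnion (x := e) he h)
    · refine hf3 y c (Set.mem_biUnion (x := e) he hc) ?_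
      have : (δ : ℝ) = ((N : ℝ) + 1)⁻¹ := by simp [δ]
      rw [this, ← one_div, le_div_iff₀ (by positivity)] at hyc
      exact hyc)
  have hdisj : ∀ j k y, j < k → (d j).2 y ≠ 0 → (d k).2 y = 0 := by
    intro j k y hjk hy
    obtain ⟨c, hc, hyc⟩ := (hd j).2.1 y hy
    exact (hr j k hjk).2 y c hc hyc.le
  let F : LipZero n X := LipZero.mk n (fun y => ∑' k, (d k).2 y)
    (lipschitzWith_tsum_of_disjoint (fun k => (hd k).1) hdisj) (by simp [LipZero.map_zero])
  -- On the carrier of the `k`-th member all later functions vanish, and the member annihilates the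
  -- earlier ones; only its own function remains.
  have hF : ∀ k, x (d k).1 F = x (d k).1 (d k).2 := by
    intro k
    have h1 : x (d k).1 (F - ∑ j ∈ Finset.range (k + 1), (d j).2) = 0 := by
      refine apply_eq_zero_of_mem_deltaSpan (hC _) fun y hy => ?_
      have h2 : ∀ j ∉ Finset.range (k + 1), (d j).2 y = 0 := by
        intro j hj
        rw [Finset.mem_range, not_lt] at hj
        exact (hr k j hj).2 y y hy (by simp)
      have h3 : ∀ s : Finset ℕ, (∑ j ∈ s, (d j).2 : LipZero n X) y = ∑ j ∈ s, (d j).2 y := by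
        intro s
        exact map_sum (deltaMap n y) _ _
      have h4 : F y = ∑ j ∈ Finset.range (k + 1), (d j).2 y := tsum_eq_sum h2
      exact sub_eq_zero.2 (h4.trans (h3 _).symm)
    rw [map_sub, map_sum, sub_eq_zero, Finset.sum_range_succ, Finset.sum_eq_zero, zero_add] at h1
    · exact h1
    · intro j hj
      exact (hr j k (Finset.mem_range.1 hj)).1
  have hinj : Function.Injective fun k => (d k).1 := by
    have h : ∀ j k, j < k → (d j).1 ≠ (d k).1 := by
      intro j k hjk h
      have h1 := (hr j k hjk).1
      have h2 := (hd j).2.2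
      rw [← h] at h1
      rw [h1, norm_zero] at h2
      linarith
    intro j k hjk
    rcases lt_trichotomy j k with h' | h' | h'
    · exact absurd hjk (h j k h')
    · exact h'
    · exact absurd hjk.symm (h k j h')
  refine Set.infinite_of_injective_forall_mem hinj (fun k => ?_) (hfin F 1 one_pos)
  rw [Set.mem_ofPred_eq, hF]
  exact (hd k).2.2

/-- A family in `Fⁿ(X)` which is weakly null along the cofinite filter has only countably many
nonzero members. -/
theorem countable_ne_zero_of_mem_lipFree {ι : Type*} {x : ι → StrongDual ℂ (LipZero n X)}
    (hx : ∀ i, x i ∈ lipFree n X)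
    (hfin : ∀ φ : StrongDual ℂ (StrongDual ℂ (LipZero n X)), ∀ ε > 0, {i | ε ≤ ‖φ (x i)‖}.Finite) :
    {i | x i ≠ 0}.Countable := by
  have hcount : ∀ φ : StrongDual ℂ (StrongDual ℂ (LipZero n X)), {i | φ (x i) ≠ 0}.Countable := by
    intro φ
    refine (Set.countable_iUnion fun k : ℕ =>
      (hfin φ (1 / (k + 1)) (by positivity)).countable).mono fun i hi => ?_
    obtain ⟨k, hk⟩ := exists_nat_one_div_lt (norm_pos_iff.2 hi)
    exact Set.mem_iUnion.2 ⟨k, hk.le⟩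
  obtain ⟨E, hE, hEx⟩ := exists_countable_deltaSpan hx fun f =>
    hfin (ContinuousLinearMap.apply ℂ ℂ f)
  obtain ⟨D, hD, hDE⟩ : TopologicalSpace.IsSeparable
      (deltaSpan n E : Set (StrongDual ℂ (LipZero n X))) :=
    (hE.image _).isSeparable.span.closure
  -- If the norming functionals of all `w ∈ D` vanish at `x i`, then `‖w‖ = ‖φ w (x i - w)‖ ≤ ‖x i -
  -- w‖`; letting `w` approach `x i` forces `x i = 0`.
  choose φ hφ hφw using fun w : StrongDual ℂ (LipZero n X) => exists_dual_vector'' ℂ w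
  refine (hEx.union (hD.biUnion fun w _ => hcount (φ w))).mono fun i hi => ?_
  by_contra! h
  rw [Set.mem_union, not_or, Set.mem_ofPred_eq, not_not] at h
  obtain ⟨h1, h2⟩ := h
  have h3 : ∀ w ∈ D, φ w (x i) = 0 := by
    intro w hw
    by_contra h
    exact h2 (Set.mem_biUnion hw h)
  refine hi (norm_le_zero_iff.1 (le_of_forall_pos_le_add fun ε hε => ?_))
  obtain ⟨w, hw, hwx⟩ := Metric.mem_closure_iff.1 (hDE h1) (ε / 2) (by positivity)
  rw [dist_eq_norm] at hwx
  have h4 : ‖w‖ ≤ ‖x i - w‖ := by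
    have h5 : φ w (x i - w) = -‖w‖ := by rw [map_sub, h3 w hw, hφw, zero_sub]; rfl
    have h6 := (φ w).le_of_opNorm_le (hφ w) (x i - w)
    rw [h5] at h6
    simpa using h6
  have h7 : ‖x i‖ ≤ ‖x i - w‖ + ‖w‖ := by simpa using norm_add_le (x i - w) w
  linarith

end

/-- Real functionals are small on all but finitely many members of an orthonormal family. -/
theorem finite_le_of_orthonormal {K : Type*} [NormedAddCommGroup K] [InnerProductSpace ℂ K]
    {ι : Type*} {b : ι → K} (hb : Orthonormal ℂ b) (ψ : K →L[ℝ] ℝ) {ε : ℝ} (hε : 0 < ε) :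
    {i | ε ≤ ψ (b i)}.Finite := by
  by_contra hinf
  -- A sum of `m` orthonormal vectors has norm `√m`, so `m ε ≤ ‖ψ‖ √m`, which bounds `m` by `(‖ψ‖ /
  -- ε) ^ 2`.
  obtain ⟨m, hm⟩ := exists_nat_gt ((‖ψ‖ / ε) ^ 2)
  obtain ⟨t, ht, rfl⟩ := Set.Infinite.exists_subset_card_eq hinf m
  have h1 : ‖∑ i ∈ t, b i‖ ^ 2 = t.card := by
    have h := hb.inner_sum (fun _ => 1) (fun _ => 1) t
    simp only [one_smul, map_one, mul_one, Finset.sum_const, nsmul_eq_mul] at h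
    rw [@norm_sq_eq_re_inner ℂ, h]
    simp
  have h2 : t.card * ε ≤ ‖ψ‖ * ‖∑ i ∈ t, b i‖ := by
    refine le_trans ?_ ((le_abs_self _).trans (ψ.le_opNorm _))
    rw [map_sum, ← nsmul_eq_mul]
    exact Finset.card_nsmul_le_sum _ _ _ fun i hi => ht hi
  have h3 : (t.card * ε) ^ 2 ≤ ‖ψ‖ ^ 2 * t.card := by
    calc (t.card * ε) ^ 2 ≤ (‖ψ‖ * ‖∑ i ∈ t, b i‖) ^ 2 := ?_
      _ = ‖ψ‖ ^ 2 * t.card := by rw [mul_pow, h1]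
    exact pow_le_pow_left₀ (by positivity) h2 2
  rw [div_pow, div_lt_iff₀ (by positivity)] at hm
  have h0 : (0 : ℝ) < t.card := by
    rcases (Nat.cast_nonneg (α := ℝ) t.card).eq_or_lt with h | h
    · rw [← h, zero_mul] at hm
      exact absurd hm (not_lt.2 (sq_nonneg _))
    · exact h
  nlinarith

/-- A complex number of modulus at least `ε` has one of `± re`, `± im` at least `ε / 2`. Only real
linearity of `ψ` is available in the application, as `T` is merely `ℝ`-linear. -/
theorem finite_le_norm_of_orthonormal {K : Type*} [NormedAddCommGroup K] [InnerProductSpace ℂ K]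
    {ι : Type*} {b : ι → K} (hb : Orthonormal ℂ b) (ψ : K →L[ℝ] ℂ) {ε : ℝ} (hε : 0 < ε) :
    {i | ε ≤ ‖ψ (b i)‖}.Finite := by
  have h : ∀ θ : ℂ →L[ℝ] ℝ, {i | ε / 2 ≤ θ (ψ (b i))}.Finite := fun θ =>
    finite_le_of_orthonormal hb (θ ∘L ψ) (by positivity)
  refine (((h Complex.reCLM).union (h (-Complex.reCLM))).union
    ((h Complex.imCLM).union (h (-Complex.imCLM)))).subset fun i hi => ?_
  rw [Set.mem_ofPred_eq] at hi
  have h1 := hi.trans (Complex.norm_le_abs_re_add_abs_im _)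
  simp only [Set.mem_union, Set.mem_ofPred_eq, neg_apply, Complex.reCLM_apply,
    Complex.imCLM_apply]
  by_contra! h
  obtain ⟨⟨h2, h3⟩, h4, h5⟩ := h
  have h6 : |(ψ (b i)).re| < ε / 2 := abs_lt.2 ⟨by linarith, h2⟩
  have h7 : |(ψ (b i)).im| < ε / 2 := abs_lt.2 ⟨by linarith, h4⟩
  linarith

theorem finite_le_norm_dual_of_orthonormal {K H Y : Type*} [NormedAddCommGroup K]
    [InnerProductSpace ℂ K] [NormedAddCommGroup H] [NormedSpace ℂ H] [NormedAddCommGroup Y]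
    [NormedSpace ℂ Y] {ι : Type*} {b : ι → K} (hb : Orthonormal ℂ b) (S : K →L[ℂ] H)
    (T : H →L[ℝ] Y) (φ : StrongDual ℂ Y) {ε : ℝ} (hε : 0 < ε) :
    {i | ε ≤ ‖φ (T (S (b i)))‖}.Finite :=
  finite_le_norm_of_orthonormal hb (φ.restrictScalars ℝ ∘L T ∘L S.restrictScalars ℝ) hε

/-- The coordinate projections of a `c₀`-sum. -/
def c0Eval {ι : Type v} (E : ι → Type u) [∀ i, NormedAddCommGroup (E i)]
    [∀ i, NormedSpace ℂ (E i)] (i : ι) : c0Sum E →L[ℂ] E i :=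
  lp.evalCLM ℂ E ∞ i ∘L (c0Sum E).subtypeL

theorem separableSpace_of_hilbertBasis_countable {K : Type*} [NormedAddCommGroup K]
    [InnerProductSpace ℂ K] {ι : Type*} [Countable ι] (b : HilbertBasis ι ℂ K) :
    TopologicalSpace.SeparableSpace K := by
  rw [← TopologicalSpace.isSeparable_univ_iff]
  have h := (Set.countable_range b).isSeparable.span (R := ℂ) |>.closure
  have h' := b.dense_span
  rw [← SetLike.coe_set_eq, Submodule.topologicalClosure_coe, Submodule.top_coe] at h'
  rwa [h'] at h

/-- A nonseparable Hilbertian operator space does not embed in a `c₀`-sum of Lipschitz-free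
operator spaces. -/
theorem not_rIsomorphicallyEmbeds_c0Sum_lipFree {H : Type u} [NormedAddCommGroup H]
    [NormedSpace ℂ H] (hH : Hilbertian H) (hs : ¬ TopologicalSpace.SeparableSpace H)
    (X : Type v) [NormedAddCommGroup X] [NormedSpace ℂ X] [OperatorStructure X] :
    ¬ RIsomorphicallyEmbeds H (c0Sum fun n : ℕ+ => lipFree n X) := by
  rintro ⟨T, c, hc, hT⟩
  obtain ⟨K, _, _, _, ⟨e⟩⟩ := hH
  obtain ⟨w, b, -⟩ := exists_hilbertBasis ℂ K
  let x : (n : ℕ+) → w → StrongDual ℂ (LipZero n X) := fun n i =>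
    ((T (e.symm (b i)) : lp (fun n : ℕ+ => lipFree n X) ∞) n : StrongDual ℂ (LipZero n X))
  have hx : ∀ n, {i | x n i ≠ 0}.Countable := by
    intro n
    refine countable_ne_zero_of_mem_lipFree (fun i => Subtype.mem _) fun φ ε hε => ?_
    exact finite_le_norm_dual_of_orthonormal b.orthonormal (e.symm : K →L[ℂ] H) T
      (φ ∘L (lipFree n X).subtypeL ∘L c0Eval (fun n : ℕ+ => lipFree n X) n) hε
  have hw : Countable w := by
    rw [← Set.countable_univ_iff]
    -- An index outside this countable union has `T (e.symm (b i)) = 0` in every coordinate, against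
    -- the lower bound on `T`.
    refine (Set.countable_iUnion hx).mono fun i _ => ?_
    by_contra! h
    have h1 : ∀ n, x n i = 0 := fun n => by
      by_contra h'
      exact h (Set.mem_iUnion.2 ⟨n, h'⟩)
    have h2 : T (e.symm (b i)) = 0 := by
      refine Subtype.ext (lp.ext (funext fun n => Subtype.ext (h1 n)))
    have h3 := hT (e.symm (b i))
    rw [h2, norm_zero] at h3
    have h4 : e.symm (b i) = 0 := norm_le_zero_iff.1 (nonpos_of_mul_nonpos_right h3 hc)
    rw [EmbeddingLike.map_eq_zero_iff] at h4
    exact b.orthonormal.ne_zero i h4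
  have := separableSpace_of_hilbertBasis_countable b
  exact hs (e.symm.surjective.denseRange.separableSpace e.symm.continuous)

/-- Every normed space carries an operator space structure (the minimal one). -/
theorem nonempty_operatorStructure (V : Type u) [NormedAddCommGroup V] [NormedSpace ℂ V] :
    Nonempty (OperatorStructure V) := by
  -- Each functional acts on the one-dimensional Hilbert space, with weight its norm; Hahn–Banach
  -- makes the family norming.
  let L : StrongDual ℂ V → V →ₗ[ℂ] (ℂ →L[ℂ] ℂ) := fun φ =>
    { toFun := fun v => φ v • ContinuousLinearMap.id ℂ ℂ
      map_add' := fun x y => by rw [map_add]; exact add_smul (φ x) (φ y) (ContinuousLinearMap.id ℂ ℂ)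
      map_smul' := fun c x => by rw [map_smul]; exact smul_assoc c (φ x) (ContinuousLinearMap.id ℂ ℂ) }
  have hL : ∀ φ v, ‖L φ v‖ = ‖φ v‖ := fun φ v => by
    change ‖φ v • ContinuousLinearMap.id ℂ ℂ‖ = _
    rw [norm_smul, ContinuousLinearMap.norm_id, mul_one]
  exact ⟨⟨_, exists_rep_of_family (fun φ : StrongDual ℂ V => ‖φ‖) (fun φ => norm_nonneg φ) L
    (fun φ v => by rw [hL, mul_comm]; exact φ.le_opNorm v)
    (fun v C hC h => NormedSpace.norm_le_dual_bound ℂ v hC fun φ => by rw [← hL]; exact h φ)⟩⟩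

/-- In `ℓ²` over an index set of the size of `ℝ`, the balls of radius `1 / 2` about the basis
vectors are disjoint, since these are `√2` apart. -/
theorem exists_hilbertian_not_separable :
    ∃ (X : Type u) (_ : NormedAddCommGroup X) (_ : NormedSpace ℂ X) (_ : CompleteSpace X)
      (_ : OperatorStructure X), Hilbertian X ∧ ¬ TopologicalSpace.SeparableSpace X := by
  let ι := ULift.{u} ℝ
  obtain ⟨o⟩ := nonempty_operatorStructure (lp (fun _ : ι => ℂ) 2)
  refine ⟨lp (fun _ : ι => ℂ) 2, inferInstance, inferInstance, inferInstance, o,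
    ⟨lp (fun _ : ι => ℂ) 2, inferInstance, inferInstance, inferInstance, ⟨.refl ℂ _⟩⟩, fun _ => ?_⟩
  let b : HilbertBasis ι ℂ (lp (fun _ : ι => ℂ) 2) := HilbertBasis.ofRepr (.refl ℂ _)
  have hsep : ∀ i j : ι, i ≠ j → Disjoint (Metric.ball (b i) (1 / 2)) (Metric.ball (b j) (1 / 2)) := by
    intro i j hij
    refine Metric.ball_disjoint_ball ?_
    have h1 : ‖b i - b j‖ ^ 2 = 2 := by
      rw [@norm_sub_sq ℂ, b.orthonormal.2 hij, b.orthonormal.1, b.orthonormal.1]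
      norm_num
    rw [dist_eq_norm]
    nlinarith [norm_nonneg (b i - b j)]
  have hc : Countable ι := by
    rw [← Set.countable_univ_iff]
    exact Set.PairwiseDisjoint.countable_of_isOpen (s := fun i => Metric.ball (b i) (1 / 2))
      (fun i _ j _ hij => hsep i j hij) (fun i _ => Metric.isOpen_ball)
      fun i _ => ⟨b i, Metric.mem_ball_self (by norm_num)⟩
  exact not_countable (α := ℝ) ((Equiv.ulift.{u} (α := ℝ)).symm.injective.countable)

/-! ### Comparison of the notions of embeddability -/

section embeddings

variable {X : Type u} {Y : Type v} [NormedAddCommGroup X] [NormedSpace ℂ X] [OperatorStructure X]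
  [NormedAddCommGroup Y] [NormedSpace ℂ Y] [OperatorStructure Y]

theorem IsNIsometry.distortion_le {n : ℕ} {f : X → Y} (hf : IsNIsometry n f) :
    distortion n f ≤ ENNReal.ofReal 1 :=
  iInf₂_le (1 : ℝ) ⟨one_pos, 1, one_pos, fun A B => by rw [hf A B]; simp⟩

theorem exists_bounds_of_distortion_lt_top {n : ℕ} {f : X → Y} (h : distortion n f < ∞) :
    ∃ D > 0, ∃ r > 0, ∀ A B : Matrix (Fin n) (Fin n) X,
      r * mnorm n (A - B) ≤ mnorm n (A.map f - B.map f) ∧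
        mnorm n (A.map f - B.map f) ≤ D * r * mnorm n (A - B) := by
  rw [distortion, iInf_lt_iff] at h
  obtain ⟨D, hD⟩ := h
  rw [iInf_lt_iff] at hD
  obtain ⟨⟨h1, h2⟩, -⟩ := hD
  exact ⟨D, h1, h2⟩

/-- Comparing a `1 × 1` matrix with `0` turns the distortion estimate for a linear map into
boundedness above and below. -/
theorem rIsomorphicallyEmbeds_of_distortion_lt_top (f : X →ₗ[ℝ] Y) (h : distortion 1 f < ∞) :
    RIsomorphicallyEmbeds X Y := by
  obtain ⟨D, -, r, hr, hf⟩ := exists_bounds_of_distortion_lt_top h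
  have key : ∀ x, r * ‖x‖ ≤ ‖f x‖ ∧ ‖f x‖ ≤ D * r * ‖x‖ := by
    intro x
    have := hf (Matrix.of fun _ _ => x) 0
    rw [mnorm_one, mnorm_one] at this
    simpa using this
  exact ⟨f.mkContinuous (D * r) fun x => (key x).2, r, hr, fun x => (key x).1⟩

theorem AlmostCompletelyIsometricallyEmbeds.lipschitzly
    (h : AlmostCompletelyIsometricallyEmbeds X Y) : AlmostCompletelyLipschitzlyEmbeds X Y :=
  let ⟨f, hf⟩ := h
  ⟨f, 1, one_pos, fun n => (hf n).distortion_le⟩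

theorem AlmostCompletelyRIsomorphicallyEmbeds.rIsomorphicallyEmbeds
    (h : AlmostCompletelyRIsomorphicallyEmbeds X Y) : RIsomorphicallyEmbeds X Y :=
  let ⟨f, _, _, hf⟩ := h
  rIsomorphicallyEmbeds_of_distortion_lt_top (f 1) ((hf 1).trans_lt ENNReal.ofReal_lt_top)

theorem AlmostCompletelyRLinearlyIsometricallyEmbeds.rIsomorphically
    (h : AlmostCompletelyRLinearlyIsometricallyEmbeds X Y) :
    AlmostCompletelyRIsomorphicallyEmbeds X Y :=
  let ⟨f, hf⟩ := h
  ⟨f, 1, one_pos, fun n => (hf n).distortion_le⟩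

end embeddings

theorem exists_almostCompletelyIsometricallyEmbeds_not_rIsomorphicallyEmbeds :
    ∃ (X Y : Type u) (_ : NormedAddCommGroup X) (_ : NormedSpace ℂ X) (_ : CompleteSpace X)
      (_ : OperatorStructure X) (_ : NormedAddCommGroup Y) (_ : NormedSpace ℂ Y)
      (_ : CompleteSpace Y) (_ : OperatorStructure Y),
      Hilbertian X ∧ ¬ TopologicalSpace.SeparableSpace X ∧
        AlmostCompletelyIsometricallyEmbeds X Y ∧ ¬ RIsomorphicallyEmbeds X Y := by
  obtain ⟨H, _, _, _, _, hH, hs⟩ := exists_hilbertian_not_separable.{u}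
  exact ⟨H, c0Sum fun n : ℕ+ => lipFree n H, inferInstance, inferInstance, inferInstance,
    inferInstance, inferInstance, inferInstance, inferInstance, inferInstance, hH, hs,
    almostCompletelyIsometricallyEmbeds_c0Sum_lipFree H,
    not_rIsomorphicallyEmbeds_c0Sum_lipFree hH hs H⟩

end OperatorSpaces

end

open OperatorSpaces in
theorem mainTheorem1 :
    -- nonseparable Hilbertian operator spaces `H` and `Y = (⊕_n Fⁿ(H))_{c₀}`
    (∀ (H : Type u) [NormedAddCommGroup H] [NormedSpace ℂ H] [CompleteSpace H]
        [OperatorStructure H], Hilbertian H → ¬ TopologicalSpace.SeparableSpace H →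
      AlmostCompletelyIsometricallyEmbeds H (c0Sum fun n : ℕ+ => lipFree n H) ∧
        ¬ RIsomorphicallyEmbeds H (c0Sum fun n : ℕ+ => lipFree n H)) ∧
    -- there are operator spaces `X`, `Y` as claimed (with `X` Hilbertian and nonseparable)
    (∃ (X Y : Type u) (_ : NormedAddCommGroup X) (_ : NormedSpace ℂ X) (_ : CompleteSpace X)
        (_ : OperatorStructure X) (_ : NormedAddCommGroup Y) (_ : NormedSpace ℂ Y)
        (_ : CompleteSpace Y) (_ : OperatorStructure Y),
      Hilbertian X ∧ ¬ TopologicalSpace.SeparableSpace X ∧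
        AlmostCompletelyIsometricallyEmbeds X Y ∧ ¬ RIsomorphicallyEmbeds X Y) ∧
    -- almost complete isometric embeddability is strictly weaker than its `ℝ`-linear counterpart
    ((∀ (X : Type v) (Y : Type w) [NormedAddCommGroup X] [NormedSpace ℂ X] [CompleteSpace X]
        [OperatorStructure X] [NormedAddCommGroup Y] [NormedSpace ℂ Y] [CompleteSpace Y]
        [OperatorStructure Y],
        AlmostCompletelyRLinearlyIsometricallyEmbeds X Y →
          AlmostCompletelyIsometricallyEmbeds X Y) ∧
      (∃ (X Y : Type u) (_ : NormedAddCommGroup X) (_ : NormedSpace ℂ X) (_ : CompleteSpace X)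
        (_ : OperatorStructure X) (_ : NormedAddCommGroup Y) (_ : NormedSpace ℂ Y)
        (_ : CompleteSpace Y) (_ : OperatorStructure Y),
        AlmostCompletelyIsometricallyEmbeds X Y ∧
          ¬ AlmostCompletelyRLinearlyIsometricallyEmbeds X Y)) ∧
    -- almost complete Lipschitz embeddability is strictly weaker than its `ℝ`-linear counterpart
    ((∀ (X : Type v) (Y : Type w) [NormedAddCommGroup X] [NormedSpace ℂ X] [CompleteSpace X]
        [OperatorStructure X] [NormedAddCommGroup Y] [NormedSpace ℂ Y] [CompleteSpace Y]
        [OperatorStructure Y],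
        AlmostCompletelyRIsomorphicallyEmbeds X Y → AlmostCompletelyLipschitzlyEmbeds X Y) ∧
      (∃ (X Y : Type u) (_ : NormedAddCommGroup X) (_ : NormedSpace ℂ X) (_ : CompleteSpace X)
        (_ : OperatorStructure X) (_ : NormedAddCommGroup Y) (_ : NormedSpace ℂ Y)
        (_ : CompleteSpace Y) (_ : OperatorStructure Y),
        AlmostCompletelyLipschitzlyEmbeds X Y ∧
          ¬ AlmostCompletelyRIsomorphicallyEmbeds X Y)) := by
  -- One pair serves all three existence claims, because either linear notion of embedding already
  -- gives an `ℝ`-isomorphic embedding at `n = 1`.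
  obtain ⟨X, Y, i1, i2, i3, i4, i5, i6, i7, i8, hX, hs, hiso, hnot⟩ :=
    exists_almostCompletelyIsometricallyEmbeds_not_rIsomorphicallyEmbeds.{u}
  refine ⟨fun H _ _ _ _ hH hs => ⟨almostCompletelyIsometricallyEmbeds_c0Sum_lipFree H,
      not_rIsomorphicallyEmbeds_c0Sum_lipFree hH hs H⟩,
    ⟨X, Y, i1, i2, i3, i4, i5, i6, i7, i8, hX, hs, hiso, hnot⟩,
    ⟨fun X Y _ _ _ _ _ _ _ _ ⟨f, hf⟩ => ⟨fun n => f n, hf⟩,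
      ⟨X, Y, i1, i2, i3, i4, i5, i6, i7, i8, hiso,
        fun h => hnot h.rIsomorphically.rIsomorphicallyEmbeds⟩⟩,
    ⟨fun X Y _ _ _ _ _ _ _ _ ⟨f, D, hD, hf⟩ => ⟨fun n => f n, D, hD, hf⟩,
      ⟨X, Y, i1, i2, i3, i4, i5, i6, i7, i8, hiso.lipschitzly,
        fun h => hnot h.rIsomorphicallyEmbeds⟩⟩⟩
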